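/- **Conventions.** Metrics are Riemannian and smooth. $|\cdot|$ is the length of a vector, $\nabla$ the Levi-Civita derivative, $\mathrm{Ric}$ the Ricci tensor (positive on round spheres), and $L=\frac1{n-2}\bigl(\mathrm{Ric}-\frac{R}{2(n-1)}g\bigr)$ the Schouten tensor in dimension $n\ge3$. For a covariant two-tensor $H$, $(\hat H u)^\mu=H^{\mu\nu}u_\nu$. Intervals are nondegenerate; at an end point belonging to the interval, derivatives are one-sided. * A smooth curve on an interval is *parametrized by proper time* if its velocity $u$ has $|u|=1$. Such a curve is a *conformal geodesic* if, with $a=\nabla_uu$, $\nabla_u a=u\,(-|a|^2-u\cdot\hat Lu)+\hat Lu$. * An *unparametrized conformal geodesic* is a curve that becomes a conformal geodesic parametrized by proper time after a smooth reparametrization (of either orientation, with nowhere vanishing derivative). * A *spiral* to $p$ is a curve $\gamma:[0,\infty)\to\mathbb R^n$ parametrized by proper time with $\gamma(s)\to p$ as $s\to\infty$. A *spiraling conformal geodesic* is a curve that is both a spiral and a conformal geodesic after one and the same reparametrization by proper time on $[0,\infty)$. * $f(t)=O(t^\infty)$ means that $f$ is smooth for $t>0$ and that its extension by zero to $t\le0$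 is smooth. * $M=2r\,dr\,d\phi=2\check e_r\check e_\phi$ with $\check e_r=dr$, $\check e_\phi=r\,d\phi$. **Theorem.** 1. Let $n\ge 3$, let $g$ be a smooth Riemannian metric on an open set $U\subset\mathbb R^n$ and $\gamma:I\to U$ a smooth curve on an interval. Then $\gamma$ is a conformal geodesic parametrized by proper time if and only if $|u|=1$ and $\nabla_u(u\wedge a)=u\wedge\hat Lu$. If the velocity $v$ of $\gamma$ vanishes nowhere and $b=\nabla_vv$, then $\gamma$ is an unparametrized conformal geodesic if and only if $$\nabla_v\frac{v\wedge b}{|v|^3}=\frac{v\wedge\hat Lv}{|v|}.$$ 2. Let $h(r)=O(r^\infty)$. There is exactly one smooth symmetric two-tensor field $g_h$ on $\mathbb R^3$ which in cylindrical coordinates $(x,y,z)=(r\cos\phi,r\sin\phi,z)$, $r>0$, is $$ds^2=(1+h(r)^2z^4)(dr^2+r^2d\phi^2)+4h(r)z^2\,r\,dr\,d\phi+dz^2 .$$ It is positive definite exactly at the points where $h(r)^2z^4\ne1$. In particular it is a Riemannian metric on the open set $U_h=\{h(r)^2z^4<1\}$, which contains the plane $z=0$. The metric induced on this plane is $dx^2+dy^2$,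 the plane is totally geodesic, and $\mathrm{Ric}=-2h(r)M$ at its points. 3. Let $\gamma$ be the curve $r=t$, $\phi=e^{1/t}$, $t\in(0,1]$. In the Euclidean plane $\gamma$ has infinite length, and there are functions $k(t)=O(t^\infty)$ such that along $\gamma$, for $t\in(0,1]$, $$\nabla_v\frac{v\wedge b}{|v|^3}=k(t)\,\frac{v\wedge\hat Mv}{|v|}.\qquad(*)$$ Every such $k$ satisfies $k(t)=-\frac{e^{-1/t}}{t}\,(1+\varepsilon(t))$ on $(0,1]$ with some $\varepsilon(t)=O(t^\infty)$. 4. For every $k(t)=O(t^\infty)$ satisfying $(*)$ let $h=-\frac12k$. Then the curve $\gamma$, placed in the plane $z=0$ of $\mathbb R^3$, is an unparametrized conformal geodesic of $g_h$. It has infinite length, and after reparametrization by proper time it is a spiraling conformal geodesic that converges to the origin. Moreover there is a smooth Riemannian metric on the whole of $\mathbb R^3$ which coincides with $g_h$ on an open neighbourhood of the plane $z=0$; for it too, $\gamma$ is an unparametrized conformal geodesic and, after reparametrization by proper time, a spiraling conformal geodesic to the origin. Thus conformal geodesics of smooth Riemannian metrics can spiral, which is a counterexample to Tod's conjecture. 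-/

import Mathlib

open Set Filter Topology Matrix MeasureTheory
open scoped ContDiff

noncomputable section

namespace ConfGeo

/-! Riemannian geometry on an open subset of `ℝⁿ`, in Cartesian coordinates.  A symmetric covariant
two-tensor field is given by its matrix of components. -/

/-- A field of covariant two-tensors on `ℝⁿ`, by components. -/
abbrev TensorField (n : ℕ) : Type := (Fin n → ℝ) → Matrix (Fin n) (Fin n) ℝ

variable {n : ℕ}

/-- All components are smooth on `U`. -/
def SmoothTensorOn (U : Set (Fin n → ℝ)) (T : TensorField n) : Prop :=
  ∀ i j, ContDiffOn ℝ ∞ (fun p => T p i j) U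

/-- `g` is a smooth Riemannian metric on `U` (positive definiteness includes symmetry). -/
structure IsRiemannianOn (U : Set (Fin n → ℝ)) (g : TensorField n) : Prop where
  smooth : SmoothTensorOn U g
  posDef : ∀ p ∈ U, (g p).PosDef

/-- The `l`-th partial derivative. -/
def pd (l : Fin n) (f : (Fin n → ℝ) → ℝ) (p : Fin n → ℝ) : ℝ :=
  fderiv ℝ f p (Pi.single l 1)

/-- Christoffel symbols `Γ^i_{jk}` of the Levi-Civita connection. -/
def christoffel (g : TensorField n) (i j k : Fin n) (p : Fin n → ℝ) : ℝ :=
  (1 / 2) * ∑ l, (g p)⁻¹ i l *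
    (pd j (fun q => g q l k) p + pd k (fun q => g q l j) p - pd l (fun q => g q j k) p)

/-- The Ricci tensor
`R_{jk} = ∂_i Γ^i_{jk} - ∂_j Γ^i_{ik} + Γ^i_{il} Γ^l_{jk} - Γ^i_{jl} Γ^l_{ik}`
(positive on round spheres). -/
def ricci (g : TensorField n) : TensorField n := fun p => Matrix.of fun j k =>
  ∑ i, (pd i (christoffel g i j k) p - pd j (christoffel g i i k) p
    + ∑ l, (christoffel g i i l p * christoffel g l j k p
        - christoffel g i j l p * christoffel g l i k p))

/-- The scalar curvature. -/
def scalarCurvature (g : TensorField n) (p : Fin n → ℝ) : ℝ :=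
  ((g p)⁻¹ * ricci g p).trace

/-- The Schouten tensor (for `n ≥ 3`). -/
def schouten (g : TensorField n) : TensorField n := fun p =>
  (1 / ((n : ℝ) - 2)) • (ricci g p - (scalarCurvature g p / (2 * ((n : ℝ) - 1))) • g p)

/-- The inner product of two vectors at `p`. -/
def ip (g : TensorField n) (p X Y : Fin n → ℝ) : ℝ := X ⬝ᵥ (g p *ᵥ Y)

/-- The length of a vector at `p`. -/
def len (g : TensorField n) (p X : Fin n → ℝ) : ℝ := Real.sqrt (ip g p X X)

/-- `Ĥ X`, the vector with components `H^{μν} X_ν`, indices being raised and lowered with `g`. -/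
def hat (g H : TensorField n) (p X : Fin n → ℝ) : Fin n → ℝ := (g p)⁻¹ *ᵥ (H p *ᵥ X)

/-- The wedge product of two vectors, as an antisymmetric matrix. -/
def wedge (X Y : Fin n → ℝ) : Matrix (Fin n) (Fin n) ℝ := vecMulVec X Y - vecMulVec Y X

/-! Curves `γ` defined on an interval `I`.  Derivatives are taken within `I`, hence they are
one-sided at those end points that belong to `I`. -/

/-- The velocity. -/
def vel (γ : ℝ → Fin n → ℝ) (I : Set ℝ) (t : ℝ) : Fin n → ℝ := derivWithin γ I t

/-- The covariant derivative along `γ` of a vector field `X` along `γ`. -/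
def covDeriv (g : TensorField n) (γ : ℝ → Fin n → ℝ) (I : Set ℝ) (X : ℝ → Fin n → ℝ) (t : ℝ) :
    Fin n → ℝ := fun i =>
  derivWithin (fun s => X s i) I t
    + ∑ j, ∑ k, christoffel g i j k (γ t) * vel γ I t j * X t k

/-- The covariant derivative along `γ` of a field `B` of contravariant two-tensors along `γ`. -/
def covDeriv₂ (g : TensorField n) (γ : ℝ → Fin n → ℝ) (I : Set ℝ)
    (B : ℝ → Matrix (Fin n) (Fin n) ℝ) (t : ℝ) : Matrix (Fin n) (Fin n) ℝ := Matrix.of fun i j =>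
  derivWithin (fun s => B s i j) I t
    + ∑ k, ∑ l, (christoffel g i k l (γ t) * vel γ I t k * B t l j
        + christoffel g j k l (γ t) * vel γ I t k * B t i l)

/-- The acceleration `∇_v v`. -/
def acc (g : TensorField n) (γ : ℝ → Fin n → ℝ) (I : Set ℝ) : ℝ → Fin n → ℝ :=
  covDeriv g γ I (vel γ I)

/-- The length of a curve. -/
def curveLength (g : TensorField n) (γ : ℝ → Fin n → ℝ) (I : Set ℝ) : ENNReal :=
  ∫⁻ t in I, ENNReal.ofReal (len g (γ t) (vel γ I t))

/-- A smooth curve parametrized by proper time: `|u| = 1`. -/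
structure IsProperTimeCurve (g : TensorField n) (γ : ℝ → Fin n → ℝ) (I : Set ℝ) : Prop where
  smooth : ContDiffOn ℝ ∞ γ I
  unit : ∀ s ∈ I, len g (γ s) (vel γ I s) = 1

/-- A conformal geodesic parametrized by proper time:
`∇_u a = u (-|a|² - u · L̂ u) + L̂ u` with `a = ∇_u u` and `L` the Schouten tensor. -/
structure IsConformalGeodesic (g : TensorField n) (γ : ℝ → Fin n → ℝ) (I : Set ℝ) : Prop
    extends IsProperTimeCurve g γ I where
  eqn : ∀ s ∈ I, covDeriv g γ I (acc g γ I) s =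
    (-(len g (γ s) (acc g γ I s)) ^ 2
        - ip g (γ s) (vel γ I s) (hat g (schouten g) (γ s) (vel γ I s))) • vel γ I s
      + hat g (schouten g) (γ s) (vel γ I s)

/-- `τ` is a smooth change of parameter from the interval `J` onto `I`, of either orientation, with
nowhere vanishing derivative (so that its inverse is smooth as well). -/
structure IsReparametrization (τ : ℝ → ℝ) (J I : Set ℝ) : Prop where
  ordConnected : J.OrdConnected
  nontrivial : J.Nontrivial
  smooth : ContDiffOn ℝ ∞ τ J
  bijOn : BijOn τ J I
  deriv_ne : ∀ s ∈ J, derivWithin τ J s ≠ 0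

/-- An unparametrized conformal geodesic: some smooth reparametrization is a conformal geodesic
parametrized by proper time. -/
def IsUnparametrizedConformalGeodesic (g : TensorField n) (γ : ℝ → Fin n → ℝ) (I : Set ℝ) : Prop :=
  ∃ (J : Set ℝ) (τ : ℝ → ℝ), IsReparametrization τ J I ∧ IsConformalGeodesic g (γ ∘ τ) J

/-- A spiral to `p`: a curve on `ℝ₊ = [0, ∞)`, parametrized by proper time, which is eventually in
every neighbourhood of `p`. -/
structure IsSpiral (g : TensorField n) (c : ℝ → Fin n → ℝ) (p : Fin n → ℝ) : Prop
    extends IsProperTimeCurve g c (Ici 0) where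
  tendsto : Tendsto c atTop (𝓝 p)

/-- After a smooth reparametrization by proper time, which then ranges over `[0, ∞)`, the curve `γ`
(on the interval `I`) is both a conformal geodesic and a spiral to `p`. -/
def IsSpiralingConformalGeodesic (g : TensorField n) (γ : ℝ → Fin n → ℝ) (I : Set ℝ)
    (p : Fin n → ℝ) : Prop :=
  ∃ τ : ℝ → ℝ, IsReparametrization τ (Ici 0) I ∧
    IsConformalGeodesic g (γ ∘ τ) (Ici 0) ∧ IsSpiral g (γ ∘ τ) p

/-- The equation `∇_v ((v ∧ b) / |v|³) = (v ∧ L̂ v) / |v|` with `b = ∇_v v`, for a general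
covariant two-tensor field `L`. -/
def WedgeEquation (g L : TensorField n) (γ : ℝ → Fin n → ℝ) (I : Set ℝ) (t : ℝ) : Prop :=
  covDeriv₂ g γ I
      (fun s => (1 / (len g (γ s) (vel γ I s)) ^ 3) • wedge (vel γ I s) (acc g γ I s)) t =
    (1 / len g (γ t) (vel γ I t)) • wedge (vel γ I t) (hat g L (γ t) (vel γ I t))

/-- `f(t) = O(t^∞)`: a smooth function on the half-line `t > 0` whose extension by zero to `t ≤ 0`
is smooth. Such a function is identified with its extension. -/
def FlatAtZero (f : ℝ → ℝ) : Prop := ContDiff ℝ ∞ f ∧ ∀ t ≤ 0, f t = 0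

/-! The Euclidean plane. -/

/-- The Euclidean metric `dx² + dy²`. -/
def euclideanPlane : TensorField 2 := fun _ => 1

/-- The distance to the origin of the plane. -/
def radius₂ (p : Fin 2 → ℝ) : ℝ := Real.sqrt (p 0 ^ 2 + p 1 ^ 2)

/-- `M = 2 e_r e_φ = 2 r dr dφ` on the punctured plane, with `e_r = dr`, `e_φ = r dφ`. -/
def tensorM₂ : TensorField 2 := fun p =>
  let er : Fin 2 → ℝ := ![p 0 / radius₂ p, p 1 / radius₂ p]
  let ef : Fin 2 → ℝ := ![-p 1 / radius₂ p, p 0 / radius₂ p]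
  vecMulVec er ef + vecMulVec ef er

/-- The curve `r = t`, `φ = exp (1/t)` in the plane. -/
def spiralCurve₂ (t : ℝ) : Fin 2 → ℝ :=
  ![t * Real.cos (Real.exp (1 / t)), t * Real.sin (Real.exp (1 / t))]

/-- `k = O(t^∞)`, and along the curve `r = t`, `φ = exp (1/t)`, `t ∈ (0, 1]`, of the Euclidean plane
`∇_v ((v ∧ b) / |v|³) = k(t) (v ∧ M̂ v) / |v|`. -/
def IsSpiralFunction (k : ℝ → ℝ) : Prop :=
  FlatAtZero k ∧ ∀ t ∈ Ioc (0 : ℝ) 1,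
    WedgeEquation euclideanPlane (fun p => k t • tensorM₂ p) spiralCurve₂ (Ioc 0 1) t

/-! Three-dimensional space. -/

/-- The distance to the `z`-axis. -/
def radius (p : Fin 3 → ℝ) : ℝ := Real.sqrt (p 0 ^ 2 + p 1 ^ 2)

/-- `M = 2 e_r e_φ = 2 r dr dφ` away from the `z`-axis, with `e_r = dr`, `e_φ = r dφ`. -/
def tensorM : TensorField 3 := fun p =>
  let er : Fin 3 → ℝ := ![p 0 / radius p, p 1 / radius p, 0]
  let ef : Fin 3 → ℝ := ![-p 1 / radius p, p 0 / radius p, 0]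
  vecMulVec er ef + vecMulVec ef er

/-- The plane `z = 0`. -/
def planeZ : Set (Fin 3 → ℝ) := {p | p 2 = 0}

/-- Cylindrical coordinates `(r, φ, z) ↦ (r cos φ, r sin φ, z)`. -/
def cyl (q : Fin 3 → ℝ) : Fin 3 → ℝ := ![q 0 * Real.cos (q 1), q 0 * Real.sin (q 1), q 2]

/-- `g` is a smooth symmetric two-tensor field on the whole of `ℝ³` whose pull-back by cylindrical
coordinates is, as a quadratic form,
`(1 + h(r)² z⁴) (dr² + r² dφ²) + 4 h(r) z² r dr dφ + dz²`. -/
structure HasSpiralLineElement (h : ℝ → ℝ) (g : TensorField 3) : Prop where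
  smooth : SmoothTensorOn univ g
  symm : ∀ p, (g p).IsSymm
  lineElement : ∀ q : Fin 3 → ℝ, 0 < q 0 → ∀ w : Fin 3 → ℝ,
    ip g (cyl q) (fderiv ℝ cyl q w) (fderiv ℝ cyl q w) =
      (1 + h (q 0) ^ 2 * q 2 ^ 4) * (w 0 ^ 2 + q 0 ^ 2 * w 1 ^ 2)
        + 4 * h (q 0) * q 2 ^ 2 * q 0 * w 0 * w 1 + w 2 ^ 2

/-- The region `h(r)² z⁴ < 1` around the plane `z = 0`. -/
def regularRegion (h : ℝ → ℝ) : Set (Fin 3 → ℝ) := {p | h (radius p) ^ 2 * p 2 ^ 4 < 1}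

/-- The curve `r = t`, `φ = exp (1/t)`, `z = 0` in space. -/
def spiralCurve (t : ℝ) : Fin 3 → ℝ :=
  ![t * Real.cos (Real.exp (1 / t)), t * Real.sin (Real.exp (1 / t)), 0]

end ConfGeo

end

open ConfGeo

/-! Wedge form. Since `a ∧ a = 0`, `∇_u (u ∧ a) = u ∧ ∇_u a`, so the wedge equation says exactly
that `∇_u a - L̂ u` is a multiple of `u`. The multiple is forced: differentiating `|u|² = 1` twice
gives `u · a = 0` and `u · ∇_u a = -|a|²` (`isConformalGeodesic_iff_wedge`). Under a change of
parameter `v ∧ b` scales by the cube of the derivative, so `(v ∧ b) / |v|³` changes only by a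
locally constant sign (`wedgeEquation_comp_iff`). The inverse of the arc length then produces proper
time.

Metric. With `β = h(r) / r²`, the metric is the square of the symmetric matrix `B = 1 + z² β r² M`,
in which `r² M` is polynomial and `β` is smooth because `h` is flat. Hence positivity amounts to
`det B = 1 - h² z⁴ ≠ 0`. The metric has the form `1 + z² A`, so its Christoffel symbols are `z`
times continuous functions near the plane `z = 0`: they vanish there, and the Ricci tensor sees only
their `z`-derivatives. As `A` is tangential and trace free on the plane, `Ric = -A = -2 h M`
(`ricci_eq_neg_on_planeZ`). The scalar curvature vanishes, so the Schouten tensor in dimension three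
is also `-2 h M`.

Spiral. For a curve in a totally geodesic flat plane the wedge equation is one scalar equation for
the derivative of the curvature `κ` (`IsPlanarCurve.wedgeEquation_iff`). With `E = exp (1/t)` the
velocity is `e_r - (E/t) e_φ`, so the coefficient of `v ∧ M̂ v` is `1 - (E/t)²`, which is nonzero on
`(0, 1]`. The equation can therefore be solved for `k`, uniquely. The solution is rational in `t`
and `E`; written in powers of `1/E = exp (-1/t)` it is `-(exp (-1/t) / t)(1 + ε)` with `ε` flat.
Choosing `h = -k/2` makes the Schouten tensor `k M` on the plane, so the spiral solves the equation
in space.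

Completeness in proper time follows from speed at least `1/t`, whose integral diverges at `0`. A
global metric is obtained by damping `β` where `h z²` is not small, which changes nothing near the
plane. -/

noncomputable section

namespace ConfGeo

variable {n : ℕ}

/-! ### Smoothness of the inverse matrix and of the Christoffel symbols -/

theorem uniqueDiffOn_of_ordConnected {I : Set ℝ} (hI : I.OrdConnected) (hn : I.Nontrivial) :
    UniqueDiffOn ℝ I :=
  uniqueDiffOn_convex hI.convex (hI.convex.nontrivial_iff_nonempty_interior.1 hn)

theorem contDiffOn_det {E : Type*} [NormedAddCommGroup E] [NormedSpace ℝ E] {U : Set E}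
    {A : E → Matrix (Fin n) (Fin n) ℝ} (hA : ∀ i j, ContDiffOn ℝ ∞ (fun p => A p i j) U) :
    ContDiffOn ℝ ∞ (fun p => (A p).det) U := by
  simp only [Matrix.det_apply]
  refine ContDiffOn.sum fun σ _ => ?_
  refine ContDiffOn.const_smul _ ?_
  exact contDiffOn_prod fun i _ => hA _ _

/-- Cramer's rule: an entry of the inverse is a quotient of determinants, which are polynomial in
the entries. -/
theorem contDiffOn_inv_apply {E : Type*} [NormedAddCommGroup E] [NormedSpace ℝ E] {U : Set E}
    {A : E → Matrix (Fin n) (Fin n) ℝ} (hA : ∀ i j, ContDiffOn ℝ ∞ (fun p => A p i j) U)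
    (hdet : ∀ p ∈ U, (A p).det ≠ 0) (i j : Fin n) :
    ContDiffOn ℝ ∞ (fun p => (A p)⁻¹ i j) U := by
  have h : (fun p => (A p)⁻¹ i j) =
      fun p => ((A p).det)⁻¹ * ((A p).updateRow j (Pi.single i 1)).det := by
    funext p
    rw [Matrix.inv_def, Matrix.smul_apply, Matrix.adjugate_apply, Ring.inverse_eq_inv', smul_eq_mul]
  rw [h]
  refine ((contDiffOn_det hA).inv hdet).mul (contDiffOn_det fun a b => ?_)
  by_cases hab : a = j
  · subst hab; simpa using contDiffOn_const
  · simpa [Matrix.updateRow_ne hab] using hA a b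

theorem contDiffOn_pd {U : Set (Fin n → ℝ)} (hU : IsOpen U) {f : (Fin n → ℝ) → ℝ}
    (hf : ContDiffOn ℝ ∞ f U) (l : Fin n) : ContDiffOn ℝ ∞ (pd l f) U :=
  (hf.fderiv_of_isOpen hU (m := ∞) (by simp)).clm_apply contDiffOn_const

theorem IsRiemannianOn.det_ne_zero {U : Set (Fin n → ℝ)} {g : TensorField n}
    (hg : IsRiemannianOn U g) {p : Fin n → ℝ} (hp : p ∈ U) : (g p).det ≠ 0 :=
  (hg.posDef p hp).det_pos.ne'

theorem IsRiemannianOn.symm {U : Set (Fin n → ℝ)} {g : TensorField n}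
    (hg : IsRiemannianOn U g) {p : Fin n → ℝ} (hp : p ∈ U) (i j : Fin n) : g p i j = g p j i := by
  simpa using (hg.posDef p hp).isHermitian.apply j i

theorem contDiffOn_christoffel {U : Set (Fin n → ℝ)} {g : TensorField n} (hU : IsOpen U)
    (hg : IsRiemannianOn U g) (i j k : Fin n) : ContDiffOn ℝ ∞ (christoffel g i j k) U := by
  unfold christoffel
  refine contDiffOn_const.mul (ContDiffOn.sum fun l _ => ?_)
  refine (contDiffOn_inv_apply hg.smooth (fun p hp => hg.det_ne_zero hp) i l).mul ?_
  exact ((contDiffOn_pd hU (hg.smooth _ _) _).add (contDiffOn_pd hU (hg.smooth _ _) _)).sub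
    (contDiffOn_pd hU (hg.smooth _ _) _)

/-! ### The inner product -/

theorem ip_eq_sum (g : TensorField n) (p X Y : Fin n → ℝ) :
    ip g p X Y = ∑ i, ∑ j, g p i j * X i * Y j := by
  simp only [ip, dotProduct, mulVec, Finset.mul_sum]
  exact Finset.sum_congr rfl fun i _ => Finset.sum_congr rfl fun j _ => by ring

theorem ip_add_left (g : TensorField n) (p X Y Z : Fin n → ℝ) :
    ip g p (X + Y) Z = ip g p X Z + ip g p Y Z := by simp [ip, add_dotProduct]

theorem ip_sub_left (g : TensorField n) (p X Y Z : Fin n → ℝ) :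
    ip g p (X - Y) Z = ip g p X Z - ip g p Y Z := by simp [ip, sub_dotProduct]

theorem ip_smul_left (g : TensorField n) (p : Fin n → ℝ) (c : ℝ) (X Y : Fin n → ℝ) :
    ip g p (c • X) Y = c * ip g p X Y := by simp [ip]

theorem ip_smul_right (g : TensorField n) (p : Fin n → ℝ) (c : ℝ) (X Y : Fin n → ℝ) :
    ip g p X (c • Y) = c * ip g p X Y := by simp [ip, mulVec_smul]

theorem len_smul (g : TensorField n) (p : Fin n → ℝ) (c : ℝ) (X : Fin n → ℝ) :
    len g p (c • X) = |c| * len g p X := by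
  rw [len, ip_smul_left, ip_smul_right, ← mul_assoc, Real.sqrt_mul (mul_self_nonneg c),
    Real.sqrt_mul_self_eq_abs, len]

theorem ip_comm {g : TensorField n} {p : Fin n → ℝ} (hs : ∀ i j, g p i j = g p j i)
    (X Y : Fin n → ℝ) : ip g p X Y = ip g p Y X := by
  rw [ip_eq_sum, ip_eq_sum, Finset.sum_comm]
  refine Finset.sum_congr rfl fun i _ => Finset.sum_congr rfl fun j _ => ?_
  rw [hs j i]; ring

theorem IsRiemannianOn.ip_self_pos {U : Set (Fin n → ℝ)} {g : TensorField n}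
    (hg : IsRiemannianOn U g) {p : Fin n → ℝ} (hp : p ∈ U) {X : Fin n → ℝ} (hX : X ≠ 0) :
    0 < ip g p X X := by
  simpa [ip] using (hg.posDef p hp).dotProduct_mulVec_pos hX

theorem IsRiemannianOn.ip_self_nonneg {U : Set (Fin n → ℝ)} {g : TensorField n}
    (hg : IsRiemannianOn U g) {p : Fin n → ℝ} (hp : p ∈ U) (X : Fin n → ℝ) :
    0 ≤ ip g p X X := by
  by_cases hX : X = 0
  · simp [hX, ip]
  · exact (hg.ip_self_pos hp hX).le

theorem IsRiemannianOn.len_pos {U : Set (Fin n → ℝ)} {g : TensorField n}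
    (hg : IsRiemannianOn U g) {p : Fin n → ℝ} (hp : p ∈ U) {X : Fin n → ℝ} (hX : X ≠ 0) :
    0 < len g p X := Real.sqrt_pos.2 (hg.ip_self_pos hp hX)

/-! ### The wedge product -/

theorem wedge_self (X : Fin n → ℝ) : wedge X X = 0 := by simp [wedge]

theorem wedge_apply (X Y : Fin n → ℝ) (i j : Fin n) : wedge X Y i j = X i * Y j - Y i * X j := by
  simp [wedge, vecMulVec_apply]

theorem wedge_add_right (X Y Z : Fin n → ℝ) : wedge X (Y + Z) = wedge X Y + wedge X Z := by
  ext i j; simp only [wedge_apply, Matrix.add_apply, Pi.add_apply]; ring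

theorem wedge_smul_right (c : ℝ) (X Y : Fin n → ℝ) : wedge X (c • Y) = c • wedge X Y := by
  ext i j; simp only [wedge_apply, Matrix.smul_apply, Pi.smul_apply, smul_eq_mul]; ring

theorem wedge_smul_left (c : ℝ) (X Y : Fin n → ℝ) : wedge (c • X) Y = c • wedge X Y := by
  ext i j; simp only [wedge_apply, Matrix.smul_apply, Pi.smul_apply, smul_eq_mul]; ring

/-- A vector whose wedge product with a unit vector `u` vanishes is a multiple of `u`. -/
theorem eq_smul_of_wedge_eq {g : TensorField n} {p u w w' : Fin n → ℝ} (hu : ip g p u u = 1)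
    (h : wedge u w = wedge u w') : w = (ip g p w u - ip g p w' u) • u + w' := by
  have key : ∀ i j, u i * (w j - w' j) = (w i - w' i) * u j := by
    intro i j
    have := congrFun (congrFun h i) j
    simp only [wedge_apply] at this
    linarith
  rw [← ip_sub_left]
  funext i
  have h1 : u i * ip g p (w - w') u = (w i - w' i) * ip g p u u := by
    simp only [ip_eq_sum, Finset.mul_sum]
    refine Finset.sum_congr rfl fun a _ => Finset.sum_congr rfl fun b _ => ?_
    have := key i a
    simp only [Pi.sub_apply]
    linear_combination (g p a b * u b) * this
  rw [hu] at h1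
  simp only [Pi.add_apply, Pi.smul_apply, smul_eq_mul]
  linarith

/-! ### Covariant derivatives along curves -/

/-- The contraction `Γ^i_{jk} V^j X^k`. -/
def conn (g : TensorField n) (p V X : Fin n → ℝ) : Fin n → ℝ := fun i =>
  ∑ j, ∑ k, christoffel g i j k p * V j * X k

theorem conn_smul_right (g : TensorField n) (p V X : Fin n → ℝ) (c : ℝ) :
    conn g p V (c • X) = c • conn g p V X := by
  funext i
  simp only [conn, Pi.smul_apply, smul_eq_mul, Finset.mul_sum]
  exact Finset.sum_congr rfl fun a _ => Finset.sum_congr rfl fun b _ => by ring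

theorem conn_smul_left (g : TensorField n) (p V X : Fin n → ℝ) (c : ℝ) :
    conn g p (c • V) X = c • conn g p V X := by
  funext i
  simp only [conn, Pi.smul_apply, smul_eq_mul, Finset.mul_sum]
  exact Finset.sum_congr rfl fun a _ => Finset.sum_congr rfl fun b _ => by ring

theorem covDeriv_eq {g : TensorField n} {γ : ℝ → Fin n → ℝ} {I : Set ℝ} {X : ℝ → Fin n → ℝ}
    {t : ℝ} {X' : Fin n → ℝ} (hu : UniqueDiffWithinAt ℝ I t) (hX : HasDerivWithinAt X X' I t) :
    covDeriv g γ I X t = X' + conn g (γ t) (vel γ I t) (X t) := by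
  funext i
  simp only [covDeriv, conn, Pi.add_apply]
  rw [((hasDerivWithinAt_pi.1 hX) i).derivWithin hu]

theorem covDeriv₂_eq {g : TensorField n} {γ : ℝ → Fin n → ℝ} {I : Set ℝ}
    {B : ℝ → Matrix (Fin n) (Fin n) ℝ} {t : ℝ} {B' : Matrix (Fin n) (Fin n) ℝ}
    (hu : UniqueDiffWithinAt ℝ I t)
    (hB : ∀ i j, HasDerivWithinAt (fun s => B s i j) (B' i j) I t) :
    covDeriv₂ g γ I B t = Matrix.of fun i j => B' i j +
      (conn g (γ t) (vel γ I t) (fun l => B t l j) i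
        + conn g (γ t) (vel γ I t) (fun l => B t i l) j) := by
  ext i j
  simp only [covDeriv₂, conn, Matrix.of_apply]
  rw [(hB i j).derivWithin hu]
  simp only [Finset.sum_add_distrib]

theorem conn_sub_right (g : TensorField n) (p V X Y : Fin n → ℝ) :
    conn g p V (X - Y) = conn g p V X - conn g p V Y := by
  funext i
  simp only [conn, Pi.sub_apply, mul_sub, Finset.sum_sub_distrib]

theorem covDeriv₂_wedge {g : TensorField n} {γ : ℝ → Fin n → ℝ} {I : Set ℝ} {X Y : ℝ → Fin n → ℝ}
    {t : ℝ} (hu : UniqueDiffWithinAt ℝ I t) (hX : DifferentiableWithinAt ℝ X I t)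
    (hY : DifferentiableWithinAt ℝ Y I t) :
    covDeriv₂ g γ I (fun s => wedge (X s) (Y s)) t =
      wedge (covDeriv g γ I X t) (Y t) + wedge (X t) (covDeriv g γ I Y t) := by
  have hX' := hX.hasDerivWithinAt
  have hY' := hY.hasDerivWithinAt
  set X' := derivWithin X I t
  set Y' := derivWithin Y I t
  have hXi := hasDerivWithinAt_pi.1 hX'
  have hYi := hasDerivWithinAt_pi.1 hY'
  rw [covDeriv_eq hu hX', covDeriv_eq hu hY',
    covDeriv₂_eq (B' := wedge X' (Y t) + wedge (X t) Y') hu]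
  · ext i j
    have e1 : (fun l => wedge (X t) (Y t) l j) = (Y t j) • X t - (X t j) • Y t := by
      funext l; simp [wedge_apply]; ring
    have e2 : (fun l => wedge (X t) (Y t) i l) = (X t i) • Y t - (Y t i) • X t := by
      funext l; simp [wedge_apply]
    rw [Matrix.of_apply, e1, e2]
    simp only [conn_sub_right, conn_smul_right, Matrix.add_apply, wedge_apply, Pi.add_apply,
      Pi.sub_apply, Pi.smul_apply, smul_eq_mul]
    ring
  · intro i j
    simp only [wedge_apply, Matrix.add_apply]
    exact (((hXi i).mul (hYi j)).sub ((hYi i).mul (hXi j))).congr_deriv (by ring)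

/-- The Christoffel symbols with the first index lowered. -/
theorem sum_mul_christoffel {g : TensorField n} {p : Fin n → ℝ} (hdet : (g p).det ≠ 0)
    (m j k : Fin n) : ∑ i, g p m i * christoffel g i j k p = (1 / 2) *
      (pd j (fun q => g q m k) p + pd k (fun q => g q m j) p - pd m (fun q => g q j k) p) := by
  have h := Matrix.mul_nonsing_inv (g p) (isUnit_iff_ne_zero.2 hdet)
  simp only [christoffel]
  calc _ = (1 / 2) * ∑ l, (∑ i, g p m i * (g p)⁻¹ i l) *
        (pd j (fun q => g q l k) p + pd k (fun q => g q l j) p - pd l (fun q => g q j k) p) := by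
        simp only [Finset.mul_sum, Finset.sum_mul]
        rw [Finset.sum_comm]
        exact Finset.sum_congr rfl fun a _ => Finset.sum_congr rfl fun b _ => by ring
    _ = _ := by
        simp only [← Matrix.mul_apply, h, Matrix.one_apply]
        simp

/-- Metric compatibility at a point. After lowering the index, the two derivative terms
antisymmetric in the slots of `X` and `Y` cancel and the remaining halves add up. -/
theorem ip_conn_add_ip_conn {U : Set (Fin n → ℝ)} {g : TensorField n} (hU : IsOpen U)
    (hg : IsRiemannianOn U g) {p : Fin n → ℝ} (hp : p ∈ U) (V X Y : Fin n → ℝ) :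
    ip g p (conn g p V X) Y + ip g p X (conn g p V Y) =
      ∑ i, ∑ j, (∑ k, V k * pd k (fun q => g q i j) p) * X i * Y j := by
  have hs : ∀ l i j, pd l (fun q => g q i j) p = pd l (fun q => g q j i) p := by
    intro l i j
    have : (fun q => g q i j) =ᶠ[𝓝 p] fun q => g q j i := by
      filter_upwards [hU.mem_nhds hp] with q hq using hg.symm hq i j
    simp only [pd, this.fderiv_eq]
  have hlow : ∀ X Y : Fin n → ℝ, ip g p X (conn g p V Y) = ∑ m, ∑ j, ∑ k, X m * V j * Y k *
      ((1 / 2) * (pd j (fun q => g q m k) p + pd k (fun q => g q m j) p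
        - pd m (fun q => g q j k) p)) := by
    intro X Y
    simp only [← sum_mul_christoffel (hg.det_ne_zero hp), ip_eq_sum, conn, Finset.mul_sum]
    refine Finset.sum_congr rfl fun m _ => ?_
    rw [Finset.sum_comm]
    refine Finset.sum_congr rfl fun j _ => ?_
    rw [Finset.sum_comm]
    exact Finset.sum_congr rfl fun a _ => Finset.sum_congr rfl fun b _ => by ring
  rw [ip_comm (hg.symm hp) (conn g p V X) Y, hlow, hlow]
  -- Exchanging the outer and inner summation indices gives both sums the same monomial in `V`, `X`,
  -- `Y`, so they can be compared term by term.
  have e1 : (∑ m, ∑ j, ∑ k, Y m * V j * X k *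
      ((1 / 2) * (pd j (fun q => g q m k) p + pd k (fun q => g q m j) p
        - pd m (fun q => g q j k) p))) = ∑ m, ∑ j, ∑ k, Y k * V j * X m *
      ((1 / 2) * (pd j (fun q => g q k m) p + pd m (fun q => g q k j) p
        - pd k (fun q => g q j m) p)) := by
    rw [Finset.sum_comm]
    rw [Finset.sum_comm (γ := Fin n) (s := Finset.univ) (t := Finset.univ)
      (f := fun m j => ∑ k, Y k * V j * X m *
      ((1 / 2) * (pd j (fun q => g q k m) p + pd m (fun q => g q k j) p
        - pd k (fun q => g q j m) p)))]
    refine Finset.sum_congr rfl fun j _ => ?_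
    rw [Finset.sum_comm]
  rw [e1, ← Finset.sum_add_distrib]
  refine Finset.sum_congr rfl fun m _ => ?_
  rw [← Finset.sum_add_distrib]
  simp only [Finset.sum_mul]
  rw [Finset.sum_comm (f := fun x i => V i * pd i (fun q => g q m x) p * X m * Y x)]
  refine Finset.sum_congr rfl fun j _ => ?_
  rw [← Finset.sum_add_distrib]
  refine Finset.sum_congr rfl fun k _ => ?_
  rw [hs j k m, hs m k j, hs k j m]
  ring

theorem fderiv_eq_sum_pd (f : (Fin n → ℝ) → ℝ) (p V : Fin n → ℝ) :
    fderiv ℝ f p V = ∑ k, V k * pd k f p := by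
  conv_lhs => rw [pi_eq_sum_univ' V]
  simp [pd, map_sum]

/-- The Levi-Civita connection is metric. -/
theorem hasDerivWithinAt_ip {U : Set (Fin n → ℝ)} {g : TensorField n} (hU : IsOpen U)
    (hg : IsRiemannianOn U g) {I : Set ℝ} {γ : ℝ → Fin n → ℝ} {t : ℝ}
    (hu : UniqueDiffWithinAt ℝ I t) (hγt : γ t ∈ U) (hγ : DifferentiableWithinAt ℝ γ I t)
    {X Y : ℝ → Fin n → ℝ} (hX : DifferentiableWithinAt ℝ X I t)
    (hY : DifferentiableWithinAt ℝ Y I t) :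
    HasDerivWithinAt (fun s => ip g (γ s) (X s) (Y s))
      (ip g (γ t) (covDeriv g γ I X t) (Y t) + ip g (γ t) (X t) (covDeriv g γ I Y t)) I t := by
  have hX' := hX.hasDerivWithinAt
  have hY' := hY.hasDerivWithinAt
  have hγ' : HasDerivWithinAt γ (vel γ I t) I t := hγ.hasDerivWithinAt
  have hXi := hasDerivWithinAt_pi.1 hX'
  have hYi := hasDerivWithinAt_pi.1 hY'
  have hgd : ∀ i j, HasDerivWithinAt (fun s => g (γ s) i j)
      (∑ k, vel γ I t k * pd k (fun q => g q i j) (γ t)) I t := by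
    intro i j
    have h1 : DifferentiableAt ℝ (fun q => g q i j) (γ t) :=
      ((hg.smooth i j).contDiffAt (hU.mem_nhds hγt)).differentiableAt (by simp)
    rw [← fderiv_eq_sum_pd]
    exact h1.hasFDerivAt.comp_hasDerivWithinAt t hγ'
  have hmain : HasDerivWithinAt (fun s => ip g (γ s) (X s) (Y s))
      (∑ i, ∑ j, (((∑ k, vel γ I t k * pd k (fun q => g q i j) (γ t)) * X t i +
        g (γ t) i j * derivWithin X I t i) * Y t j +
        g (γ t) i j * X t i * derivWithin Y I t j)) I t := by
    simp only [ip_eq_sum]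
    exact HasDerivWithinAt.fun_sum fun i _ => HasDerivWithinAt.fun_sum fun j _ =>
      ((hgd i j).mul (hXi i)).mul (hYi j)
  convert hmain using 1
  rw [covDeriv_eq hu hX', covDeriv_eq hu hY', ip_add_left,
    ip_comm (hg.symm hγt) (X t), ip_add_left, ip_comm (hg.symm hγt) _ (X t),
    ip_comm (hg.symm hγt) _ (X t)]
  have := ip_conn_add_ip_conn hU hg hγt (vel γ I t) (X t) (Y t)
  have e : ∀ a b c d : ℝ, a + b + (c + d) = a + c + (b + d) := by intros; ring
  rw [e, this, ip_eq_sum, ip_eq_sum]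
  simp only [← Finset.sum_add_distrib]
  exact Finset.sum_congr rfl fun i _ => Finset.sum_congr rfl fun j _ => by ring

theorem contDiffOn_vel {γ : ℝ → Fin n → ℝ} {I : Set ℝ} (hI : UniqueDiffOn ℝ I)
    (hγ : ContDiffOn ℝ ∞ γ I) : ContDiffOn ℝ ∞ (vel γ I) I :=
  hγ.derivWithin hI (by simp)

theorem contDiffOn_covDeriv {U : Set (Fin n → ℝ)} {g : TensorField n} (hU : IsOpen U)
    (hg : IsRiemannianOn U g) {I : Set ℝ} {γ : ℝ → Fin n → ℝ} (hI : UniqueDiffOn ℝ I)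
    (hγ : ContDiffOn ℝ ∞ γ I) (hm : MapsTo γ I U) {X : ℝ → Fin n → ℝ}
    (hX : ContDiffOn ℝ ∞ X I) : ContDiffOn ℝ ∞ (covDeriv g γ I X) I := by
  refine contDiffOn_pi.2 fun i => ?_
  unfold covDeriv
  refine ((contDiffOn_pi.1 hX i).derivWithin hI (by simp)).add
    (ContDiffOn.sum fun j _ => ContDiffOn.sum fun k _ => ?_)
  exact (((contDiffOn_christoffel hU hg i j k).comp hγ hm).mul
    (contDiffOn_pi.1 (contDiffOn_vel hI hγ) j)).mul (contDiffOn_pi.1 hX k)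

theorem contDiffOn_acc {U : Set (Fin n → ℝ)} {g : TensorField n} (hU : IsOpen U)
    (hg : IsRiemannianOn U g) {I : Set ℝ} {γ : ℝ → Fin n → ℝ} (hI : UniqueDiffOn ℝ I)
    (hγ : ContDiffOn ℝ ∞ γ I) (hm : MapsTo γ I U) : ContDiffOn ℝ ∞ (acc g γ I) I :=
  contDiffOn_covDeriv hU hg hI hγ hm (contDiffOn_vel hI hγ)

theorem contDiffOn_ip {U : Set (Fin n → ℝ)} {g : TensorField n} (hg : SmoothTensorOn U g)
    {I : Set ℝ} {γ X Y : ℝ → Fin n → ℝ} (hγ : ContDiffOn ℝ ∞ γ I) (hm : MapsTo γ I U)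
    (hX : ContDiffOn ℝ ∞ X I) (hY : ContDiffOn ℝ ∞ Y I) :
    ContDiffOn ℝ ∞ (fun s => ip g (γ s) (X s) (Y s)) I := by
  simp only [ip_eq_sum]
  exact ContDiffOn.sum fun i _ => ContDiffOn.sum fun j _ =>
    (((hg i j).comp hγ hm).mul (contDiffOn_pi.1 hX i)).mul (contDiffOn_pi.1 hY j)

theorem contDiffOn_len_vel {U : Set (Fin n → ℝ)} {g : TensorField n} (hg : IsRiemannianOn U g)
    {I : Set ℝ} {γ : ℝ → Fin n → ℝ} (hI : UniqueDiffOn ℝ I) (hγ : ContDiffOn ℝ ∞ γ I)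
    (hm : MapsTo γ I U) (hv : ∀ t ∈ I, vel γ I t ≠ 0) :
    ContDiffOn ℝ ∞ (fun s => len g (γ s) (vel γ I s)) I :=
  (contDiffOn_ip hg.smooth hγ hm (contDiffOn_vel hI hγ) (contDiffOn_vel hI hγ)).sqrt
    fun t ht => (hg.ip_self_pos (hm ht) (hv t ht)).ne'

/-- The conformal geodesic equation in terms of wedge products. -/
theorem isConformalGeodesic_iff_wedge {U : Set (Fin n → ℝ)} {g : TensorField n} (hU : IsOpen U)
    (hg : IsRiemannianOn U g) {I : Set ℝ} {γ : ℝ → Fin n → ℝ} (hI : UniqueDiffOn ℝ I)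
    (hγ : ContDiffOn ℝ ∞ γ I) (hm : MapsTo γ I U) :
    IsConformalGeodesic g γ I ↔
      ∀ s ∈ I, len g (γ s) (vel γ I s) = 1 ∧
        covDeriv₂ g γ I (fun s' => wedge (vel γ I s') (acc g γ I s')) s =
          wedge (vel γ I s) (hat g (schouten g) (γ s) (vel γ I s)) := by
  have hdv := (contDiffOn_vel hI hγ).differentiableOn (by simp)
  have hda := (contDiffOn_acc hU hg hI hγ hm).differentiableOn (by simp)
  have hdγ := hγ.differentiableOn (by simp)
  have hW : ∀ s ∈ I, covDeriv₂ g γ I (fun s' => wedge (vel γ I s') (acc g γ I s')) s =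
      wedge (vel γ I s) (covDeriv g γ I (acc g γ I) s) := by
    intro s hs
    rw [covDeriv₂_wedge (hI s hs) (hdv s hs) (hda s hs)]
    change wedge (acc g γ I s) (acc g γ I s) + _ = _
    rw [wedge_self, zero_add]
  constructor
  · intro h s hs
    refine ⟨h.unit s hs, ?_⟩
    rw [hW s hs, h.eqn s hs, wedge_add_right, wedge_smul_right, wedge_self, smul_zero, zero_add]
  · intro h
    have hunit : ∀ s ∈ I, ip g (γ s) (vel γ I s) (vel γ I s) = 1 := by
      intro s hs
      have := (h s hs).1
      rwa [len, Real.sqrt_eq_one] at this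
    -- `|u|²` is constant along the curve. Differentiating the resulting orthogonality once more
    -- gives `horth'`, which supplies the coefficient of `u` in the equation.
    have horth : ∀ s ∈ I, ip g (γ s) (vel γ I s) (acc g γ I s) = 0 := by
      intro s hs
      have h1 := hasDerivWithinAt_ip hU hg (hI s hs) (hm hs) (hdγ s hs) (hdv s hs) (hdv s hs)
      have h2 : HasDerivWithinAt (fun s => ip g (γ s) (vel γ I s) (vel γ I s)) 0 I s :=
        (hasDerivWithinAt_const s I (1 : ℝ)).congr hunit (hunit s hs)
      have h3 := (hI s hs).eq_deriv _ h1 h2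
      change ip g (γ s) (acc g γ I s) _ + ip g (γ s) _ (acc g γ I s) = 0 at h3
      rw [ip_comm (hg.symm (hm hs)) (acc g γ I s)] at h3
      linarith
    have horth' : ∀ s ∈ I, ip g (γ s) (covDeriv g γ I (acc g γ I) s) (vel γ I s) =
        -(len g (γ s) (acc g γ I s)) ^ 2 := by
      intro s hs
      have h1 := hasDerivWithinAt_ip hU hg (hI s hs) (hm hs) (hdγ s hs) (hdv s hs) (hda s hs)
      have h2 : HasDerivWithinAt (fun s => ip g (γ s) (vel γ I s) (acc g γ I s)) 0 I s :=
        (hasDerivWithinAt_const s I (0 : ℝ)).congr horth (horth s hs)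
      have h3 := (hI s hs).eq_deriv _ h1 h2
      change ip g (γ s) (acc g γ I s) _ + _ = 0 at h3
      rw [len, Real.sq_sqrt (hg.ip_self_nonneg (hm hs) _),
        ip_comm (hg.symm (hm hs)) _ (vel γ I s)]
      linarith
    refine ⟨⟨hγ, fun s hs => (h s hs).1⟩, fun s hs => ?_⟩
    have h1 := (h s hs).2
    rw [hW s hs] at h1
    have h2 := eq_smul_of_wedge_eq (hunit s hs) h1
    rw [horth' s hs, ip_comm (hg.symm (hm hs)) (hat _ _ _ _)] at h2
    exact h2

/-! ### Reparametrization -/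

theorem IsReparametrization.uniqueDiffOn {τ : ℝ → ℝ} {J I : Set ℝ}
    (h : IsReparametrization τ J I) : UniqueDiffOn ℝ J :=
  uniqueDiffOn_of_ordConnected h.ordConnected h.nontrivial

theorem IsReparametrization.hasDerivWithinAt {τ : ℝ → ℝ} {J I : Set ℝ}
    (h : IsReparametrization τ J I) {s : ℝ} (hs : s ∈ J) :
    HasDerivWithinAt τ (derivWithin τ J s) J s :=
  (h.smooth.differentiableOn (by simp) s hs).hasDerivWithinAt

theorem hat_smul (g L : TensorField n) (p : Fin n → ℝ) (c : ℝ) (X : Fin n → ℝ) :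
    hat g L p (c • X) = c • hat g L p X := by simp [hat, mulVec_smul]

theorem vel_comp {γ : ℝ → Fin n → ℝ} {τ : ℝ → ℝ} {J I : Set ℝ} (hτ : IsReparametrization τ J I)
    (hγ : DifferentiableOn ℝ γ I) {s : ℝ} (hs : s ∈ J) :
    vel (γ ∘ τ) J s = derivWithin τ J s • vel γ I (τ s) :=
  ((hγ _ (hτ.bijOn.mapsTo hs)).hasDerivWithinAt.scomp s (hτ.hasDerivWithinAt hs)
    hτ.bijOn.mapsTo).derivWithin (hτ.uniqueDiffOn s hs)

/-- The chain rule for `τ' • v(τ)`. The term with the second derivative is parallel to the velocity,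
so it disappears in the wedge product. -/
theorem acc_comp {g : TensorField n} {γ : ℝ → Fin n → ℝ} {τ : ℝ → ℝ} {J I : Set ℝ}
    (hτ : IsReparametrization τ J I) (hI : UniqueDiffOn ℝ I) (hγ : ContDiffOn ℝ ∞ γ I)
    {s : ℝ} (hs : s ∈ J) :
    acc g (γ ∘ τ) J s = derivWithin (derivWithin τ J) J s • vel γ I (τ s)
      + derivWithin τ J s ^ 2 • acc g γ I (τ s) := by
  have hJ := hτ.uniqueDiffOn
  have hdγ := hγ.differentiableOn (by simp : (∞ : WithTop ℕ∞) ≠ 0)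
  have hv := ((contDiffOn_vel hI hγ).differentiableOn (by simp) (τ s)
    (hτ.bijOn.mapsTo hs)).hasDerivWithinAt
  have hτ2 := ((hτ.smooth.derivWithin hJ (m := ∞) (by simp)).differentiableOn (by simp) s
    hs).hasDerivWithinAt
  have h1 := (hτ2.smul (hv.scomp s (hτ.hasDerivWithinAt hs) hτ.bijOn.mapsTo)).congr_of_mem
    (f₁ := vel (γ ∘ τ) J) (fun x hx => vel_comp hτ hdγ hx) hs
  rw [acc, covDeriv_eq (hJ s hs) h1, acc, covDeriv_eq (hI _ (hτ.bijOn.mapsTo hs)) hv,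
    vel_comp hτ hdγ hs, conn_smul_left, conn_smul_right]
  simp only [Function.comp_apply, smul_add, smul_smul, pow_two]
  abel

theorem contDiffOn_wedge_vel_acc {U : Set (Fin n → ℝ)} {g : TensorField n} (hU : IsOpen U)
    (hg : IsRiemannianOn U g) {I : Set ℝ} {γ : ℝ → Fin n → ℝ} (hI : UniqueDiffOn ℝ I)
    (hγ : ContDiffOn ℝ ∞ γ I) (hm : MapsTo γ I U) (hv : ∀ t ∈ I, vel γ I t ≠ 0) (i j : Fin n) :
    ContDiffOn ℝ ∞ (fun s => ((1 / (len g (γ s) (vel γ I s)) ^ 3) •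
      wedge (vel γ I s) (acc g γ I s)) i j) I := by
  have hvel := contDiffOn_pi.1 (contDiffOn_vel hI hγ)
  have hacc := contDiffOn_pi.1 (contDiffOn_acc hU hg hI hγ hm)
  simp only [Matrix.smul_apply, wedge_apply, smul_eq_mul]
  refine ContDiffOn.mul (contDiffOn_const.div ((contDiffOn_len_vel hg hI hγ hm hv).pow 3) ?_)
    (((hvel i).mul (hacc j)).sub ((hacc i).mul (hvel j)))
  exact fun t ht => pow_ne_zero _ (hg.len_pos (hm ht) (hv t ht)).ne'

/-- The factor `c` is meant to be the sign of the derivative of `τ`, which is constant only locally;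
hence the hypothesis on `C` is required only near `s`. -/
theorem covDeriv₂_smul_comp {g : TensorField n} {γ : ℝ → Fin n → ℝ} {τ : ℝ → ℝ} {J I : Set ℝ}
    (hτ : IsReparametrization τ J I) (hI : UniqueDiffOn ℝ I) (hγ : DifferentiableOn ℝ γ I)
    {s : ℝ} (hs : s ∈ J) {B C : ℝ → Matrix (Fin n) (Fin n) ℝ} (c : ℝ)
    (hB : ∀ i j, DifferentiableOn ℝ (fun t => B t i j) I)
    (hC : ∀ᶠ x in 𝓝[J] s, C x = c • B (τ x)) :
    covDeriv₂ g (γ ∘ τ) J C s = (c * derivWithin τ J s) • covDeriv₂ g γ I B (τ s) := by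
  have hJ := hτ.uniqueDiffOn
  have hB' : ∀ i j, HasDerivWithinAt (fun t => B t i j)
      (Matrix.of (fun i j => derivWithin (fun t => B t i j) I (τ s)) i j) I (τ s) :=
    fun i j => (hB i j _ (hτ.bijOn.mapsTo hs)).hasDerivWithinAt
  have hCs : C s = c • B (τ s) := hC.self_of_nhdsWithin hs
  have hC' : ∀ i j, HasDerivWithinAt (fun x => C x i j)
      (((c * derivWithin τ J s) • Matrix.of
        (fun i j => derivWithin (fun t => B t i j) I (τ s))) i j) J s := by
    intro i j
    have h1 := ((hB' i j).scomp s (hτ.hasDerivWithinAt hs) hτ.bijOn.mapsTo).const_mul c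
    refine (h1.congr_of_eventuallyEq (f₁ := fun x => C x i j) ?_ ?_).congr_deriv ?_
    · filter_upwards [hC] with x hx
      simp [hx]
    · simp [hCs]
    · simp [mul_assoc]
  rw [covDeriv₂_eq (hJ s hs) hC', covDeriv₂_eq (hI _ (hτ.bijOn.mapsTo hs)) hB',
    vel_comp hτ hγ hs, hCs]
  ext i j
  have e1 : (fun l => (c • B (τ s)) l j) = c • fun l => B (τ s) l j := rfl
  have e2 : (fun l => (c • B (τ s)) i l) = c • fun l => B (τ s) i l := rfl
  simp only [Matrix.of_apply]
  rw [e1, e2]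
  simp only [Matrix.of_apply, Matrix.smul_apply, conn_smul_left, conn_smul_right,
    Pi.smul_apply, smul_eq_mul, Function.comp_apply]
  ring

/-- The wedge equation is invariant under reparametrization. -/
theorem wedgeEquation_comp_iff {U : Set (Fin n → ℝ)} {g : TensorField n} (hU : IsOpen U)
    (hg : IsRiemannianOn U g) (L : TensorField n) {I J : Set ℝ} {γ : ℝ → Fin n → ℝ} {τ : ℝ → ℝ}
    (hI : UniqueDiffOn ℝ I) (hγ : ContDiffOn ℝ ∞ γ I) (hm : MapsTo γ I U)
    (hv : ∀ t ∈ I, vel γ I t ≠ 0) (hτ : IsReparametrization τ J I) {s : ℝ} (hs : s ∈ J) :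
    WedgeEquation g L (γ ∘ τ) J s ↔ WedgeEquation g L γ I (τ s) := by
  have hJ := hτ.uniqueDiffOn
  have hdγ := hγ.differentiableOn (by simp : (∞ : WithTop ℕ∞) ≠ 0)
  set d := derivWithin τ J with hd
  have hds := hτ.deriv_ne s hs
  have hcont : ContinuousWithinAt d J s :=
    ((hτ.smooth.derivWithin hJ (m := ∞) (by simp)).continuousOn) s hs
  have hsign : ∀ᶠ x in 𝓝[J] s, d x / |d x| = d s / |d s| := by
    rcases lt_or_gt_of_ne hds with h | h
    · filter_upwards [hcont.eventually (gt_mem_nhds h)] with x hx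
      rw [abs_of_neg hx, abs_of_neg h, div_neg, div_neg, div_self hx.ne, div_self h.ne]
    · filter_upwards [hcont.eventually (lt_mem_nhds h)] with x hx
      rw [abs_of_pos hx, abs_of_pos h, div_self hx.ne', div_self h.ne']
  -- `v ∧ b` picks up the cube of `d x` and `|v|³` the cube of `|d x|`, so only the sign survives.
  have hC : ∀ᶠ x in 𝓝[J] s, (1 / (len g ((γ ∘ τ) x) (vel (γ ∘ τ) J x)) ^ 3) •
      wedge (vel (γ ∘ τ) J x) (acc g (γ ∘ τ) J x) = (d s / |d s|) •
      ((1 / (len g (γ (τ x)) (vel γ I (τ x))) ^ 3) •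
        wedge (vel γ I (τ x)) (acc g γ I (τ x))) := by
    filter_upwards [hsign, self_mem_nhdsWithin] with x hx hxJ
    have hdx : |d x| ≠ 0 := abs_ne_zero.2 (hτ.deriv_ne x hxJ)
    have hl := (hg.len_pos (hm (hτ.bijOn.mapsTo hxJ)) (hv _ (hτ.bijOn.mapsTo hxJ))).ne'
    rw [vel_comp hτ hdγ hxJ, acc_comp hτ hI hγ hxJ, ← hx, ← hd, wedge_add_right,
      wedge_smul_right, wedge_smul_right, wedge_smul_left, wedge_smul_left, wedge_self, smul_zero,
      smul_zero, zero_add, Function.comp_apply, len_smul, smul_smul, smul_smul, smul_smul]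
    congr 1
    field_simp
    rw [sq_abs]
    ring
  rw [WedgeEquation, covDeriv₂_smul_comp hτ hI hdγ hs _ (fun i j =>
    (contDiffOn_wedge_vel_acc hU hg hI hγ hm hv i j).differentiableOn (by simp)) hC,
    vel_comp hτ hdγ hs, Function.comp_apply, hat_smul, wedge_smul_right, wedge_smul_left,
    len_smul, ← hd, WedgeEquation]
  -- Both sides of the equation acquire the same factor `|d s|`, which is then cancelled.
  have habs : |d s| ≠ 0 := abs_ne_zero.2 hds
  have e1 : d s / |d s| * d s = |d s| := by
    rw [div_mul_eq_mul_div, ← abs_mul_abs_self, mul_div_assoc, div_self habs, mul_one]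
  have e2 : 1 / (|d s| * len g (γ (τ s)) (vel γ I (τ s))) * (d s * d s) =
      |d s| * (1 / len g (γ (τ s)) (vel γ I (τ s))) := by
    rw [← abs_mul_abs_self (d s)]; field_simp
  rw [e1, smul_smul, smul_smul, mul_assoc, e2, ← smul_smul]
  exact (IsUnit.mk0 _ habs).smul_left_cancel

theorem wedgeEquation_iff_of_unit {g L : TensorField n} {γ : ℝ → Fin n → ℝ} {I : Set ℝ}
    (hu : ∀ t ∈ I, len g (γ t) (vel γ I t) = 1) {t : ℝ} (ht : t ∈ I) :
    WedgeEquation g L γ I t ↔ covDeriv₂ g γ I (fun s => wedge (vel γ I s) (acc g γ I s)) t =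
      wedge (vel γ I t) (hat g L (γ t) (vel γ I t)) := by
  have h1 : EqOn (fun s => (1 / (len g (γ s) (vel γ I s)) ^ 3) • wedge (vel γ I s) (acc g γ I s))
      (fun s => wedge (vel γ I s) (acc g γ I s)) I := by
    intro s hs
    simp [hu s hs]
  have h2 : covDeriv₂ g γ I (fun s => (1 / (len g (γ s) (vel γ I s)) ^ 3) •
      wedge (vel γ I s) (acc g γ I s)) t =
      covDeriv₂ g γ I (fun s => wedge (vel γ I s) (acc g γ I s)) t := by
    ext i j
    simp only [covDeriv₂, Matrix.of_apply]
    rw [derivWithin_congr (fun s hs => congrFun (congrFun (h1 hs) i) j)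
      (congrFun (congrFun (h1 ht) i) j)]
    simp only [h1 ht]
  rw [WedgeEquation, h2, hu t ht, div_one, one_smul]

/-- A solution of the wedge equation becomes a conformal geodesic after reparametrization by
proper time. -/
theorem isConformalGeodesic_comp {U : Set (Fin n → ℝ)} {g : TensorField n} (hU : IsOpen U)
    (hg : IsRiemannianOn U g) {I J : Set ℝ} {γ : ℝ → Fin n → ℝ} {τ : ℝ → ℝ}
    (hI : UniqueDiffOn ℝ I) (hγ : ContDiffOn ℝ ∞ γ I) (hm : MapsTo γ I U)
    (hv : ∀ t ∈ I, vel γ I t ≠ 0) (hτ : IsReparametrization τ J I)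
    (hunit : ∀ s ∈ J, |derivWithin τ J s| * len g (γ (τ s)) (vel γ I (τ s)) = 1)
    (hw : ∀ t ∈ I, WedgeEquation g (schouten g) γ I t) : IsConformalGeodesic g (γ ∘ τ) J := by
  have hdγ := hγ.differentiableOn (by simp : (∞ : WithTop ℕ∞) ≠ 0)
  have hu : ∀ s ∈ J, len g ((γ ∘ τ) s) (vel (γ ∘ τ) J s) = 1 := by
    intro s hs
    rw [vel_comp hτ hdγ hs, Function.comp_apply, len_smul, hunit s hs]
  rw [isConformalGeodesic_iff_wedge hU hg hτ.uniqueDiffOn (hγ.comp hτ.smooth hτ.bijOn.mapsTo)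
    (hm.comp hτ.bijOn.mapsTo)]
  exact fun s hs => ⟨hu s hs, (wedgeEquation_iff_of_unit hu hs).1
    ((wedgeEquation_comp_iff hU hg _ hI hγ hm hv hτ hs).2 (hw _ (hτ.bijOn.mapsTo hs)))⟩

/-! ### Arc length -/

/-- The fundamental theorem of calculus relative to an interval, covering one-sided derivatives at
its end points: the error is the integral of `f y - f t` between `t` and `x`, and
order-connectedness keeps `y` in `I`. -/
theorem hasDerivWithinAt_integral_of_ordConnected {I : Set ℝ} (hI : I.OrdConnected) {f : ℝ → ℝ}
    (hf : ContinuousOn f I) {t₀ t : ℝ} (ht₀ : t₀ ∈ I) (ht : t ∈ I) :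
    HasDerivWithinAt (fun x => ∫ y in t₀..x, f y) (f t) I t := by
  have hint : ∀ a ∈ I, ∀ b ∈ I, IntervalIntegrable f volume a b := fun a ha b hb =>
    (hf.mono (hI.uIcc_subset ha hb)).intervalIntegrable
  rw [hasDerivWithinAt_iff_isLittleO, Asymptotics.isLittleO_iff]
  intro c hc
  obtain ⟨δ, hδ, hball⟩ := Metric.continuousWithinAt_iff.1 (hf t ht) c hc
  filter_upwards [self_mem_nhdsWithin, mem_nhdsWithin_of_mem_nhds (Metric.ball_mem_nhds t hδ)]
    with x hx hxδ
  have e : (∫ y in t₀..x, f y) - (∫ y in t₀..t, f y) - (x - t) • f t =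
      ∫ y in t..x, (f y - f t) := by
    rw [intervalIntegral.integral_interval_sub_left (hint _ ht₀ _ hx) (hint _ ht₀ _ ht),
      intervalIntegral.integral_sub (hint _ ht _ hx) (by simp), intervalIntegral.integral_const]
  rw [e, Real.norm_eq_abs (x - t)]
  refine intervalIntegral.norm_integral_le_of_norm_le_const fun y hy => ?_
  have hyu : y ∈ uIcc t x := uIoc_subset_uIcc hy
  have hyI : y ∈ I := hI.uIcc_subset ht hx hyu
  have hyδ : dist y t < δ := by
    refine lt_of_le_of_lt ?_ hxδ
    rw [Real.dist_eq, Real.dist_eq]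
    exact abs_sub_left_of_mem_uIcc hyu
  rw [← dist_eq_norm]
  exact (hball hyI hyδ).le

theorem strictMonoOn_of_hasDerivWithinAt_pos {I : Set ℝ} (hI : I.OrdConnected) {σ f : ℝ → ℝ}
    (hσ : ∀ t ∈ I, HasDerivWithinAt σ (f t) I t) (hpos : ∀ t ∈ I, 0 < f t) :
    StrictMonoOn σ I := by
  refine strictMonoOn_of_deriv_pos hI.convex (fun t ht => (hσ t ht).continuousWithinAt)
    fun x hx => ?_
  rw [((hσ x (interior_subset hx)).hasDerivAt (mem_interior_iff_mem_nhds.1 hx)).deriv]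
  exact hpos x (interior_subset hx)

/-- The inverse of a function with smooth positive derivative on an interval is a change of
parameter. -/
theorem isReparametrization_invFunOn {I : Set ℝ} (hI : I.OrdConnected) (hn : I.Nontrivial)
    {σ f : ℝ → ℝ} (hσ : ∀ t ∈ I, HasDerivWithinAt σ (f t) I t) (hf : ContDiffOn ℝ ∞ f I)
    (hpos : ∀ t ∈ I, 0 < f t) :
    IsReparametrization (Function.invFunOn σ I) (σ '' I) I ∧
      ∀ s ∈ σ '' I, derivWithin (Function.invFunOn σ I) (σ '' I) s =
        (f (Function.invFunOn σ I s))⁻¹ := by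
  have hcont : ContinuousOn σ I := fun t ht => (hσ t ht).continuousWithinAt
  have hmono := strictMonoOn_of_hasDerivWithinAt_pos hI hσ hpos
  set τ := Function.invFunOn σ I
  set J := σ '' I
  have hτmem : ∀ s ∈ J, τ s ∈ I := fun s hs => Function.invFunOn_mem hs
  have hστ : ∀ s ∈ J, σ (τ s) = s := fun s hs => Function.invFunOn_eq hs
  have hτσ : ∀ t ∈ I, τ (σ t) = t := fun t ht =>
    hmono.injOn (hτmem _ (mem_image_of_mem _ ht)) ht (hστ _ (mem_image_of_mem _ ht))
  have hJ : J.OrdConnected := (hI.isPreconnected.image σ hcont).ordConnected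
  have hJn : J.Nontrivial := hn.image_of_injOn hmono.injOn
  have hJu := uniqueDiffOn_of_ordConnected hJ hJn
  -- A strictly monotone bijection between order-connected sets is an order isomorphism, hence a
  -- homeomorphism for the order topologies, which are the subspace topologies here.
  have hτcont : ContinuousOn τ J := by
    have := hI
    have := hJ
    rw [continuousOn_iff_continuous_domRestrict]
    have h1 : J.domRestrict τ = Subtype.val ∘ (hmono.orderIso σ I).symm := by
      funext ⟨s, hs⟩
      have h2 : (hmono.orderIso σ I) ⟨τ s, hτmem s hs⟩ = ⟨s, hs⟩ := Subtype.ext (hστ s hs)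
      rw [domRestrict_apply, Function.comp_apply, ← h2, OrderIso.symm_apply_apply, h2]
    rw [h1]
    exact continuous_subtype_val.comp (hmono.orderIso σ I).symm.continuous
  have hτd : ∀ s ∈ J, HasDerivWithinAt τ (f (τ s))⁻¹ J s := by
    intro s hs
    have h0 : f (τ s) ≠ 0 := (hpos _ (hτmem s hs)).ne'
    have h1 : HasFDerivWithinAt σ ((ContinuousLinearEquiv.unitsEquivAut ℝ (Units.mk0 _ h0) :
        ℝ ≃L[ℝ] ℝ) : ℝ →L[ℝ] ℝ) I (τ s) := by
      refine (hσ _ (hτmem s hs)).hasFDerivWithinAt.congr_fderiv ?_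
      ext; simp
    have h2 := h1.of_local_left_inverse (g := τ) (s := J)
      (tendsto_nhdsWithin_iff.2 ⟨hτcont s hs, eventually_nhdsWithin_of_forall hτmem⟩) hs
      (eventually_nhdsWithin_of_forall hστ)
    refine h2.hasDerivWithinAt.congr_deriv ?_
    simp
  have hτderiv : ∀ s ∈ J, derivWithin τ J s = (f (τ s))⁻¹ := fun s hs =>
    (hτd s hs).derivWithin (hJu s hs)
  -- Bootstrapping from the identity `τ' = 1 / (f ∘ τ)`: if `τ` is `C^m`, so is its derivative.
  have hsmooth : ∀ m : ℕ, ContDiffOn ℝ m τ J := by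
    intro m
    induction m with
    | zero => exact_mod_cast contDiffOn_zero.2 hτcont
    | succ m ih =>
      have : ((m + 1 : ℕ) : WithTop ℕ∞) = m + 1 := by push_cast; rfl
      rw [this, contDiffOn_succ_iff_derivWithin hJu]
      refine ⟨fun s hs => (hτd s hs).differentiableWithinAt, by simp, ?_⟩
      refine ContDiffOn.congr ?_ hτderiv
      exact ((hf.of_le (by exact_mod_cast le_top)).comp ih hτmem).inv
        fun s hs => (hpos _ (hτmem s hs)).ne'
  refine ⟨⟨hJ, hJn, contDiffOn_infty.2 hsmooth, ⟨hτmem, ?_, ?_⟩, ?_⟩, hτderiv⟩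
  · intro a ha b hb hab
    rw [← hστ a ha, ← hστ b hb, hab]
  · exact fun t ht => ⟨σ t, mem_image_of_mem _ ht, hτσ t ht⟩
  · intro s hs
    rw [hτderiv s hs]
    exact inv_ne_zero (hpos _ (hτmem s hs)).ne'

/-- The unparametrized conformal geodesic equation in terms of wedge products. -/
theorem isUnparametrizedConformalGeodesic_iff {U : Set (Fin n → ℝ)} {g : TensorField n}
    (hU : IsOpen U) (hg : IsRiemannianOn U g) {I : Set ℝ} {γ : ℝ → Fin n → ℝ}
    (hI : I.OrdConnected) (hn : I.Nontrivial) (hγ : ContDiffOn ℝ ∞ γ I) (hm : MapsTo γ I U)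
    (hv : ∀ t ∈ I, vel γ I t ≠ 0) :
    IsUnparametrizedConformalGeodesic g γ I ↔ ∀ t ∈ I, WedgeEquation g (schouten g) γ I t := by
  have hIu := uniqueDiffOn_of_ordConnected hI hn
  constructor
  · rintro ⟨J, τ, hτ, hc⟩ t ht
    obtain ⟨s, hs, rfl⟩ := hτ.bijOn.surjOn ht
    rw [← wedgeEquation_comp_iff hU hg _ hIu hγ hm hv hτ hs, wedgeEquation_iff_of_unit hc.unit hs]
    exact ((isConformalGeodesic_iff_wedge hU hg hτ.uniqueDiffOn hc.smooth
      (hm.comp hτ.bijOn.mapsTo)).1 hc s hs).2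
  · intro hw
    obtain ⟨t₀, ht₀⟩ := hn.nonempty
    have hlen := contDiffOn_len_vel hg hIu hγ hm hv
    have hpos : ∀ t ∈ I, 0 < len g (γ t) (vel γ I t) := fun t ht => hg.len_pos (hm ht) (hv t ht)
    -- Proper time is the arc length measured from an arbitrary `t₀`; its inverse has derivative `1
    -- / |v|`.
    obtain ⟨h1, h2⟩ := isReparametrization_invFunOn hI hn
      (fun t ht => hasDerivWithinAt_integral_of_ordConnected hI hlen.continuousOn ht₀ ht) hlen hpos
    refine ⟨_, _, h1, isConformalGeodesic_comp hU hg hIu hγ hm hv h1 (fun s hs => ?_) hw⟩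
    have h3 := hpos _ (h1.bijOn.mapsTo hs)
    rw [h2 s hs, abs_of_pos (inv_pos.2 h3), inv_mul_cancel₀ h3.ne']

/-! ### Flat functions -/

/-- A family of functions that vanish for `t ≤ 0`, are `O(t²)` as `t ↓ 0`, and whose derivatives
for `t > 0` belong to the family again, consists of flat functions. -/
theorem flatAtZero_of_mem_of_hasDerivAt (S : Set (ℝ → ℝ)) (h0 : ∀ f ∈ S, ∀ t ≤ 0, f t = 0)
    (hb : ∀ f ∈ S, ∃ C : ℝ, ∀ t ∈ Ioc (0 : ℝ) 1, |f t| ≤ C * t ^ 2)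
    (hd : ∀ f ∈ S, ∃ f' ∈ S, ∀ t, 0 < t → HasDerivAt f (f' t) t) :
    ∀ f ∈ S, FlatAtZero f := by
  have key : ∀ f ∈ S, ∃ f' ∈ S, ∀ t, HasDerivAt f (f' t) t := by
    intro f hf
    obtain ⟨f', hf', hd'⟩ := hd f hf
    refine ⟨f', hf', fun t => ?_⟩
    rcases lt_trichotomy t 0 with ht | rfl | ht
    · rw [h0 f' hf' t ht.le]
      refine (hasDerivAt_const t (0 : ℝ)).congr_of_eventuallyEq ?_
      filter_upwards [gt_mem_nhds ht] with x hx using h0 f hf x hx.le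
    · rw [h0 f' hf' 0 le_rfl, hasDerivAt_iff_isLittleO]
      obtain ⟨C, hC⟩ := hb f hf
      -- The quadratic bound makes the derivative at `0` vanish, in agreement with the value there
      -- of every member of the family.
      have h1 : (fun t => f t - f 0 - (t - 0) • (0 : ℝ)) =O[𝓝 0] fun t : ℝ => t ^ 2 := by
        refine Asymptotics.IsBigO.of_bound |C| ?_
        filter_upwards [gt_mem_nhds (zero_lt_one' ℝ)] with t ht
        rw [h0 f hf 0 le_rfl, smul_zero, sub_zero, sub_zero, Real.norm_eq_abs, Real.norm_eq_abs,
          abs_of_nonneg (sq_nonneg t)]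
        rcases le_or_gt t 0 with h | h
        · rw [h0 f hf t h, abs_zero]; positivity
        · exact (hC t ⟨h, ht.le⟩).trans (by gcongr; exact le_abs_self C)
      refine h1.trans_isLittleO ?_
      simpa using Asymptotics.isLittleO_pow_id (𝕜 := ℝ) (n := 2) (by norm_num)
    · exact hd' t ht
  have smooth : ∀ m : ℕ, ∀ f ∈ S, ContDiff ℝ m f := by
    intro m
    induction m with
    | zero =>
      intro f hf
      obtain ⟨f', -, h⟩ := key f hf
      exact_mod_cast contDiff_zero.2 (continuous_iff_continuousAt.2 fun t => (h t).continuousAt)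
    | succ m ih =>
      intro f hf
      obtain ⟨f', hf', h⟩ := key f hf
      have : ((m + 1 : ℕ) : WithTop ℕ∞) = m + 1 := by push_cast; rfl
      rw [this, contDiff_succ_iff_deriv]
      refine ⟨fun t => (h t).differentiableAt, by simp, ?_⟩
      rw [funext fun t => (h t).deriv]
      exact ih f' hf'
  exact fun f hf => ⟨contDiff_infty.2 fun m => smooth m f hf, h0 f hf⟩

namespace FlatAtZero

variable {f h : ℝ → ℝ}

protected theorem deriv (hf : FlatAtZero f) : FlatAtZero (deriv f) := by
  refine ⟨(contDiff_infty_iff_deriv.1 hf.1).2, fun t ht => ?_⟩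
  have h1 := ((hf.1.differentiable (by simp)) t).hasDerivAt.hasDerivWithinAt (s := Iic 0)
  have h2 : HasDerivWithinAt f 0 (Iic 0) t :=
    (hasDerivWithinAt_const t _ (0 : ℝ)).congr (fun x hx => hf.2 x hx) (hf.2 t ht)
  exact (uniqueDiffOn_Iic 0 t ht).eq_deriv _ h1 h2

theorem mul_left (hf : FlatAtZero f) (hh : ContDiff ℝ ∞ h) : FlatAtZero fun t => h t * f t :=
  ⟨hh.mul hf.1, fun t ht => by simp [hf.2 t ht]⟩

theorem sub (hf : FlatAtZero f) (hh : FlatAtZero h) : FlatAtZero fun t => f t - h t :=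
  ⟨hf.1.sub hh.1, fun t ht => by simp [hf.2 t ht, hh.2 t ht]⟩

/-- Induction through the mean value inequality: the derivative is flat again, and a bound `C t^N`
for it integrates to one of order `N + 1`. -/
theorem exists_le_pow (hf : FlatAtZero f) (N : ℕ) :
    ∃ C : ℝ, ∀ t ∈ Icc (0 : ℝ) 1, |f t| ≤ C * t ^ N := by
  induction N generalizing f with
  | zero =>
    obtain ⟨C, hC⟩ := isCompact_Icc.exists_bound_of_continuousOn (s := Icc (0 : ℝ) 1)
      hf.1.continuous.continuousOn
    exact ⟨C, fun t ht => by simpa using hC t ht⟩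
  | succ N ih =>
    obtain ⟨C, hC⟩ := ih hf.deriv
    refine ⟨|C|, fun t ht => ?_⟩
    have h1 : ∀ x ∈ Icc 0 t, ‖deriv f x‖ ≤ |C| * t ^ N := by
      intro x hx
      refine (hC x ⟨hx.1, hx.2.trans ht.2⟩).trans ?_
      have := hx.1
      have := hx.2
      gcongr
      exact le_abs_self C
    have h2 := (convex_Icc 0 t).norm_image_sub_le_of_norm_deriv_le
      (fun x _ => (hf.1.differentiable (by simp)) x) h1 (left_mem_Icc.2 ht.1) (right_mem_Icc.2 ht.1)
    rw [hf.2 0 le_rfl, sub_zero, sub_zero, Real.norm_eq_abs, Real.norm_eq_abs,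
      abs_of_nonneg ht.1] at h2
    rwa [pow_succ, ← mul_assoc]

/-- Quotients of flat functions by powers form a family closed under differentiation, `(f / t^m)' =
(t f' - m f) / t^(m+1)`, and flatness beats every power in the denominator. -/
theorem div_pow (hf : FlatAtZero f) (m : ℕ) : FlatAtZero fun t => f t / t ^ m := by
  refine flatAtZero_of_mem_of_hasDerivAt
    {F | ∃ (m : ℕ) (f : ℝ → ℝ), FlatAtZero f ∧ F = fun t => f t / t ^ m} ?_ ?_ ?_ _ ⟨m, f, hf, rfl⟩
  · rintro _ ⟨m, f, hf, rfl⟩ t ht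
    simp [hf.2 t ht]
  · rintro _ ⟨m, f, hf, rfl⟩
    obtain ⟨C, hC⟩ := hf.exists_le_pow (m + 2)
    refine ⟨C, fun t ht => ?_⟩
    have := ht.1
    rw [abs_div, abs_of_pos (pow_pos ht.1 m), div_le_iff₀ (pow_pos ht.1 m)]
    exact (hC t (Ioc_subset_Icc_self ht)).trans (le_of_eq (by ring))
  · rintro _ ⟨m, f, hf, rfl⟩
    refine ⟨_, ⟨m + 1, fun t => t * deriv f t - m * f t,
      (hf.deriv.mul_left contDiff_id).sub (hf.mul_left contDiff_const), rfl⟩, fun t ht => ?_⟩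
    have h1 := ((hf.1.differentiable (by simp)) t).hasDerivAt.div (hasDerivAt_pow m t)
      (pow_pos ht m).ne'
    refine h1.congr_deriv ?_
    rcases m with _ | m
    · simp; field_simp
    · simp only [Nat.add_sub_cancel]
      field_simp
      ring

/-- The derivative of `f (√s)` is `f' (√s) / (2 √s)`, again a flat function of `√s` because division
by `√s` preserves flatness. -/
theorem comp_sqrt (hf : FlatAtZero f) : FlatAtZero fun s => f (√s) := by
  refine flatAtZero_of_mem_of_hasDerivAt
    {F | ∃ f : ℝ → ℝ, FlatAtZero f ∧ F = fun s => f (√s)} ?_ ?_ ?_ _ ⟨f, hf, rfl⟩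
  · rintro _ ⟨f, hf, rfl⟩ t ht
    simp [Real.sqrt_eq_zero_of_nonpos ht, hf.2 0 le_rfl]
  · rintro _ ⟨f, hf, rfl⟩
    obtain ⟨C, hC⟩ := hf.exists_le_pow 4
    refine ⟨C, fun t ht => (hC _ ⟨Real.sqrt_nonneg _, Real.sqrt_le_one.2 ht.2⟩).trans
      (le_of_eq ?_)⟩
    rw [show (√t) ^ 4 = ((√t) ^ 2) ^ 2 by ring, Real.sq_sqrt ht.1.le]
  · rintro _ ⟨f, hf, rfl⟩
    refine ⟨_, ⟨_, (hf.deriv.div_pow 1).mul_left (contDiff_const (c := (1 / 2 : ℝ))), rfl⟩,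
      fun t ht => ?_⟩
    have h1 := ((hf.1.differentiable (by simp)) (√t)).hasDerivAt.comp t
      (Real.hasDerivAt_sqrt ht.ne')
    refine h1.congr_deriv ?_
    have := Real.sqrt_pos.2 ht
    field_simp

/-- The function `s ↦ f (√s) / s`, which expresses `f r / r²` in terms of `s = r²`. -/
theorem comp_sqrt_div (hf : FlatAtZero f) : FlatAtZero fun s => f (√s) / s := by
  simpa using hf.comp_sqrt.div_pow 1

end FlatAtZero

/-! ### Metrics that agree with the Euclidean one to first order on the plane `z = 0` -/

theorem contDiff_pd {f : (Fin n → ℝ) → ℝ} (hf : ContDiff ℝ ∞ f) (l : Fin n) :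
    ContDiff ℝ ∞ (pd l f) :=
  contDiffOn_univ.1 (contDiffOn_pd isOpen_univ hf.contDiffOn l)

section PlanePerturbation

variable {A : TensorField 3} {g : TensorField 3}

/-- The first derivatives of `1 + z² A` are `z` times this function. -/
def planeFirstDeriv (A : TensorField 3) (l i j : Fin 3) (q : Fin 3 → ℝ) : ℝ :=
  (if l = 2 then 2 * A q i j else 0) + q 2 * pd l (fun q => A q i j) q

theorem pd_one_add_sq_smul (hA : ∀ i j, ContDiff ℝ ∞ fun q => A q i j)
    (hg : ∀ q, g q = 1 + (q 2) ^ 2 • A q) (l i j : Fin 3) (q : Fin 3 → ℝ) :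
    pd l (fun q => g q i j) q = q 2 * planeFirstDeriv A l i j q := by
  have h1 : (fun q => g q i j) =
      fun q => (1 : Matrix (Fin 3) (Fin 3) ℝ) i j + (q 2) ^ 2 * A q i j := by
    funext q
    simp [hg q]
  have h2 : HasFDerivAt (fun q : Fin 3 → ℝ => (q 2) ^ 2) _ q :=
    (hasFDerivAt_apply (𝕜 := ℝ) (2 : Fin 3) q).pow 2
  have h3 := ((hA i j).differentiable (by simp) q).hasFDerivAt
  have h4 : HasFDerivAt (fun q => g q i j) _ q := h1 ▸ (h2.mul h3).const_add _
  rw [pd, h4.fderiv]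
  simp only [planeFirstDeriv, pd, _root_.add_apply, _root_.smul_apply,
    ContinuousLinearMap.proj_apply, smul_eq_mul]
  by_cases hl : l = 2
  · subst hl; simp; ring
  · simp [hl]; ring

/-- The Christoffel symbols of `1 + z² A` are `z` times this function. -/
def planeChristoffel (A g : TensorField 3) (i j k : Fin 3) (q : Fin 3 → ℝ) : ℝ :=
  (1 / 2) * ∑ l, (g q)⁻¹ i l *
    (planeFirstDeriv A j l k q + planeFirstDeriv A k l j q - planeFirstDeriv A l j k q)

theorem christoffel_eq_mul_planeChristoffel (hA : ∀ i j, ContDiff ℝ ∞ fun q => A q i j)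
    (hg : ∀ q, g q = 1 + (q 2) ^ 2 • A q) (i j k : Fin 3) :
    christoffel g i j k = fun q => q 2 * planeChristoffel A g i j k q := by
  funext q
  simp only [christoffel, planeChristoffel, pd_one_add_sq_smul hA hg, Finset.mul_sum]
  exact Finset.sum_congr rfl fun l _ => by ring

theorem christoffel_eq_zero_on_planeZ (hA : ∀ i j, ContDiff ℝ ∞ fun q => A q i j)
    (hg : ∀ q, g q = 1 + (q 2) ^ 2 • A q) {p : Fin 3 → ℝ} (hp : p ∈ planeZ) (i j k : Fin 3) :
    christoffel g i j k p = 0 := by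
  rw [christoffel_eq_mul_planeChristoffel hA hg]
  have : p 2 = 0 := hp
  simp [this]

theorem eq_one_on_planeZ (hg : ∀ q, g q = 1 + (q 2) ^ 2 • A q) {p : Fin 3 → ℝ}
    (hp : p ∈ planeZ) : g p = 1 := by
  have : p 2 = 0 := hp
  simp [hg p, this]

theorem continuousAt_planeChristoffel (hA : ∀ i j, ContDiff ℝ ∞ fun q => A q i j)
    (hg : ∀ q, g q = 1 + (q 2) ^ 2 • A q) {p : Fin 3 → ℝ} (hp : p ∈ planeZ) (i j k : Fin 3) :
    ContinuousAt (planeChristoffel A g i j k) p := by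
  have hgs : ∀ i j, ContDiff ℝ ∞ fun q => g q i j := by
    intro i j
    simp only [hg, Matrix.add_apply, Matrix.smul_apply, smul_eq_mul]
    exact contDiff_const.add (((contDiff_apply ℝ ℝ 2).pow 2).mul (hA i j))
  have hdet : Continuous fun q => (g q).det :=
    (contDiffOn_univ.1 (contDiffOn_det fun i j => (hgs i j).contDiffOn)).continuous
  have hU : IsOpen {q | (g q).det ≠ 0} := isOpen_ne_fun hdet continuous_const
  have hpU : p ∈ {q | (g q).det ≠ 0} := by simp [eq_one_on_planeZ hg hp]
  have hinv : ∀ i j, ContinuousAt (fun q => (g q)⁻¹ i j) p := fun i j =>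
    (contDiffOn_inv_apply (U := {q | (g q).det ≠ 0}) (fun i j => (hgs i j).contDiffOn)
      (fun q hq => hq) i j).continuousOn.continuousAt (hU.mem_nhds hpU)
  have hC : ∀ l i j, Continuous (planeFirstDeriv A l i j) := by
    intro l i j
    unfold planeFirstDeriv
    refine Continuous.add ?_ ((continuous_apply 2).mul (contDiff_pd (hA i j) l).continuous)
    split_ifs
    · exact continuous_const.mul (hA i j).continuous
    · exact continuous_const
  unfold planeChristoffel
  refine continuousAt_const.mul (tendsto_finsetSum _ fun l _ => (hinv i l).mul ?_)
  exact (((hC j l k).add (hC k l j)).sub (hC l j k)).continuousAt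

/-- At a point with `z = 0` one has `z G(q) - z G(p) = z · o(1)`, so `z G` is differentiable as soon
as `G` is continuous there. This spares any derivative of the inverse metric. -/
theorem pd_mul_of_continuousAt {G : (Fin 3 → ℝ) → ℝ} {p : Fin 3 → ℝ} (hp : p ∈ planeZ)
    (hG : ContinuousAt G p) (l : Fin 3) :
    pd l (fun q => q 2 * G q) p = if l = 2 then G p else 0 := by
  have hp2 : p 2 = 0 := hp
  have h : HasFDerivAt (fun q : Fin 3 → ℝ => q 2 * G q)
      (G p • (ContinuousLinearMap.proj 2 : (Fin 3 → ℝ) →L[ℝ] ℝ)) p := by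
    rw [hasFDerivAt_iff_isLittleO]
    have e : (fun q : Fin 3 → ℝ => q 2 * G q - p 2 * G p
        - (G p • (ContinuousLinearMap.proj 2 : (Fin 3 → ℝ) →L[ℝ] ℝ)) (q - p)) =
        fun q => (q - p) 2 * (G q - G p) := by
      funext q
      simp only [_root_.smul_apply, ContinuousLinearMap.proj_apply, smul_eq_mul,
        Pi.sub_apply, hp2]
      ring
    rw [e]
    have h1 : (fun q : Fin 3 → ℝ => (q - p) 2) =O[𝓝 p] fun q => q - p :=
      Asymptotics.IsBigO.of_bound 1 (Eventually.of_forall fun q => by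
        simpa using norm_le_pi_norm (q - p) 2)
    have h2 : (fun q => G q - G p) =o[𝓝 p] fun _ => (1 : ℝ) := by
      rw [Asymptotics.isLittleO_one_iff]
      have h3 : Tendsto (fun q => G q - G p) (𝓝 p) (𝓝 (G p - G p)) := hG.sub continuousAt_const
      rwa [sub_self] at h3
    have h3 := (h1.norm_right.mul_isLittleO h2).norm_right
    simpa using h3
  rw [pd, h.fderiv]
  by_cases hl : l = 2
  · subst hl; simp
  · simp [hl]

/-- The Ricci tensor of `1 + z² A` on the plane `z = 0`, for `A` trace free and tangential. -/
theorem ricci_eq_neg_on_planeZ (hA : ∀ i j, ContDiff ℝ ∞ fun q => A q i j)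
    (hg : ∀ q, g q = 1 + (q 2) ^ 2 • A q) {p : Fin 3 → ℝ} (hp : p ∈ planeZ)
    (hs : ∀ i j, A p i j = A p j i) (h2 : ∀ i, A p i 2 = 0) (htr : A p 0 0 + A p 1 1 = 0) :
    ricci g p = -A p := by
  have hp2 : p 2 = 0 := hp
  have hG : ∀ i j k, planeChristoffel A g i j k p =
      (if j = 2 then A p i k else 0) + (if k = 2 then A p i j else 0)
        - (if i = 2 then A p j k else 0) := by
    intro i j k
    simp only [planeChristoffel, eq_one_on_planeZ hg hp, inv_one, Matrix.one_apply, ite_mul,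
      one_mul, zero_mul, Finset.sum_ite_eq, Finset.mem_univ, if_true, planeFirstDeriv, hp2,
      add_zero]
    split_ifs <;> ring
  have hpd : ∀ l i j k, pd l (christoffel g i j k) p =
      if l = 2 then planeChristoffel A g i j k p else 0 := by
    intro l i j k
    rw [christoffel_eq_mul_planeChristoffel hA hg]
    exact pd_mul_of_continuousAt hp (continuousAt_planeChristoffel hA hg hp i j k) l
  have h2' : ∀ i, A p 2 i = 0 := fun i => by rw [hs, h2]
  ext j k
  -- The quadratic terms vanish. In `∂_i Γ^i_{jk}` only `i = 2` contributes, giving `-A j k`; the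
  -- term `∂_j Γ^i_{ik}` gives the trace of `A`, and only for `j = k = 2`.
  simp only [ricci, Matrix.of_apply, christoffel_eq_zero_on_planeZ hA hg hp, hpd, hG,
    Matrix.neg_apply, mul_zero, sub_self, Finset.sum_const_zero, add_zero, Fin.sum_univ_three]
  fin_cases j <;> fin_cases k <;> (simp [h2, h2']; try linarith)

end PlanePerturbation

/-! ### The spiral metrics -/

/-- The matrix of `2 r³ dr dφ`. -/
def angularMatrix : TensorField 3 := fun p =>
  !![-(2 * p 0 * p 1), p 0 ^ 2 - p 1 ^ 2, 0; p 0 ^ 2 - p 1 ^ 2, 2 * p 0 * p 1, 0; 0, 0, 0]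

/-- The symmetric square root `1 + z² β(p) · 2 r³ dr dφ` of the metric. -/
def spiralRoot (β : (Fin 3 → ℝ) → ℝ) : TensorField 3 := fun p =>
  1 + (p 2 ^ 2 * β p) • angularMatrix p

/-- The metric `(1 + β² r⁴ z⁴)(dr² + r² dφ²) + 4 β r³ z² dr dφ + dz²`. -/
def spiralMetric (β : (Fin 3 → ℝ) → ℝ) : TensorField 3 := fun p =>
  spiralRoot β p * spiralRoot β p

/-- The coefficient of `z²` in the spiral metric. -/
def spiralPerturbation (β : (Fin 3 → ℝ) → ℝ) : TensorField 3 := fun p =>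
  (2 * β p) • angularMatrix p + (p 2 ^ 2 * β p ^ 2) • (angularMatrix p * angularMatrix p)

theorem spiralMetric_eq (β : (Fin 3 → ℝ) → ℝ) (q : Fin 3 → ℝ) :
    spiralMetric β q = 1 + (q 2) ^ 2 • spiralPerturbation β q := by
  simp only [spiralMetric, spiralRoot, spiralPerturbation, add_mul, mul_add, one_mul, mul_one,
    smul_mul_smul_comm, smul_add, smul_smul, add_assoc]
  congr 1
  rw [← add_assoc, ← add_smul]
  congr 2 <;> ring

theorem radius_sq (p : Fin 3 → ℝ) : radius p ^ 2 = p 0 ^ 2 + p 1 ^ 2 :=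
  Real.sq_sqrt (by positivity)

/-- The factor `r²` clears the denominators of `M`, so the left-hand side is polynomial and smooth
across the axis. On the axis both sides are zero. -/
theorem angularMatrix_eq (p : Fin 3 → ℝ) : angularMatrix p = radius p ^ 2 • tensorM p := by
  by_cases hr : radius p = 0
  · have h := radius_sq p
    rw [hr] at h
    have h0 : p 0 = 0 := by nlinarith [sq_nonneg (p 0), sq_nonneg (p 1)]
    have h1 : p 1 = 0 := by nlinarith [sq_nonneg (p 0), sq_nonneg (p 1)]
    ext i j
    fin_cases i <;> fin_cases j <;> simp [angularMatrix, h0, h1, hr]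
  · ext i j
    fin_cases i <;> fin_cases j <;>
      simp [angularMatrix, tensorM] <;> field_simp <;> ring

theorem contDiff_angularMatrix (i j : Fin 3) : ContDiff ℝ ∞ fun p => angularMatrix p i j := by
  fin_cases i <;> fin_cases j <;> simp [angularMatrix] <;> fun_prop

theorem angularMatrix_symm (p : Fin 3 → ℝ) (i j : Fin 3) :
    angularMatrix p i j = angularMatrix p j i := by
  fin_cases i <;> fin_cases j <;> rfl

theorem contDiff_spiralPerturbation {β : (Fin 3 → ℝ) → ℝ} (hβ : ContDiff ℝ ∞ β) (i j : Fin 3) :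
    ContDiff ℝ ∞ fun p => spiralPerturbation β p i j := by
  have := contDiff_angularMatrix
  simp only [spiralPerturbation, Matrix.add_apply, Matrix.smul_apply, Matrix.mul_apply,
    smul_eq_mul]
  exact ((contDiff_const.mul hβ).mul (this i j)).add
    ((((contDiff_apply ℝ ℝ 2).pow 2).mul (hβ.pow 2)).mul
      (ContDiff.sum fun l _ => (this i l).mul (this l j)))

theorem contDiff_spiralMetric {β : (Fin 3 → ℝ) → ℝ} (hβ : ContDiff ℝ ∞ β) (i j : Fin 3) :
    ContDiff ℝ ∞ fun p => spiralMetric β p i j := by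
  simp only [spiralMetric_eq, Matrix.add_apply, Matrix.smul_apply, smul_eq_mul]
  exact contDiff_const.add (((contDiff_apply ℝ ℝ 2).pow 2).mul (contDiff_spiralPerturbation hβ i j))

theorem spiralRoot_isSymm (β : (Fin 3 → ℝ) → ℝ) (p : Fin 3 → ℝ) : (spiralRoot β p).IsSymm := by
  ext i j
  simp [spiralRoot, Matrix.one_apply, eq_comm (a := i), angularMatrix_symm p i j]

theorem spiralMetric_isSymm (β : (Fin 3 → ℝ) → ℝ) (p : Fin 3 → ℝ) :
    (spiralMetric β p).IsSymm := by
  rw [Matrix.IsSymm, spiralMetric, Matrix.transpose_mul, (spiralRoot_isSymm β p).eq]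

theorem det_spiralRoot (β : (Fin 3 → ℝ) → ℝ) (p : Fin 3 → ℝ) :
    (spiralRoot β p).det = 1 - (β p * radius p ^ 2) ^ 2 * p 2 ^ 4 := by
  rw [radius_sq, Matrix.det_fin_three]
  simp [spiralRoot, angularMatrix]
  ring

/-- The metric is `Bᵀ B` with `B` the symmetric root, hence positive definite exactly when `B` is
invertible. -/
theorem spiralMetric_posDef_iff (β : (Fin 3 → ℝ) → ℝ) (p : Fin 3 → ℝ) :
    (spiralMetric β p).PosDef ↔ (β p * radius p ^ 2) ^ 2 * p 2 ^ 4 ≠ 1 := by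
  have h1 : (β p * radius p ^ 2) ^ 2 * p 2 ^ 4 ≠ 1 ↔ (spiralRoot β p).det ≠ 0 := by
    rw [det_spiralRoot, Ne, Ne, sub_eq_zero, eq_comm]
  rw [h1]
  constructor
  · intro h h0
    have := h.det_pos
    simp [spiralMetric, h0] at this
  · intro h
    have h2 : spiralMetric β p = (spiralRoot β p)ᴴ * spiralRoot β p := by
      rw [Matrix.conjTranspose_eq_transpose_of_trivial, (spiralRoot_isSymm β p).eq]
      rfl
    rw [h2]
    exact Matrix.PosDef.conjTranspose_mul_self _
      (Matrix.mulVec_injective_of_isUnit ((Matrix.isUnit_iff_isUnit_det _).2 (isUnit_iff_ne_zero.2 h)))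

theorem ricci_spiralMetric {β : (Fin 3 → ℝ) → ℝ} (hβ : ContDiff ℝ ∞ β) {p : Fin 3 → ℝ}
    (hp : p ∈ planeZ) : ricci (spiralMetric β) p = (-2 * (β p * radius p ^ 2)) • tensorM p := by
  have hp2 : p 2 = 0 := hp
  have hAp : spiralPerturbation β p = (2 * β p) • angularMatrix p := by
    simp [spiralPerturbation, hp2]
  rw [ricci_eq_neg_on_planeZ (contDiff_spiralPerturbation hβ) (spiralMetric_eq β) hp, hAp,
    angularMatrix_eq, smul_smul, ← neg_smul]
  · congr 1; ring
  · intro i j; simp [hAp, angularMatrix_symm p i j]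
  · intro i; fin_cases i <;> simp [hAp, angularMatrix]
  · simp [hAp, angularMatrix]

theorem christoffel_spiralMetric {β : (Fin 3 → ℝ) → ℝ} (hβ : ContDiff ℝ ∞ β) {p : Fin 3 → ℝ}
    (hp : p ∈ planeZ) (i j k : Fin 3) : christoffel (spiralMetric β) i j k p = 0 :=
  christoffel_eq_zero_on_planeZ (contDiff_spiralPerturbation hβ) (spiralMetric_eq β) hp i j k

/-- `M` is trace free, so the scalar curvature vanishes on the plane, and for `n = 3` the factor `1
/ (n - 2)` is one. -/
theorem schouten_spiralMetric {β : (Fin 3 → ℝ) → ℝ} (hβ : ContDiff ℝ ∞ β) {p : Fin 3 → ℝ}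
    (hp : p ∈ planeZ) :
    schouten (spiralMetric β) p = (-2 * (β p * radius p ^ 2)) • tensorM p := by
  have htr : (tensorM p).trace = 0 := by
    simp [Matrix.trace, Fin.sum_univ_three, tensorM]
    ring
  have hR : scalarCurvature (spiralMetric β) p = 0 := by
    rw [scalarCurvature, eq_one_on_planeZ (spiralMetric_eq β) hp, inv_one, one_mul,
      ricci_spiralMetric hβ hp, Matrix.trace_smul, htr, smul_zero]
  rw [schouten, hR, ricci_spiralMetric hβ hp]
  norm_num

/-! ### The line element -/

theorem fderiv_cyl (q w : Fin 3 → ℝ) : fderiv ℝ cyl q w =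
    ![Real.cos (q 1) * w 0 - q 0 * Real.sin (q 1) * w 1,
      Real.sin (q 1) * w 0 + q 0 * Real.cos (q 1) * w 1, w 2] := by
  have h0 : HasFDerivAt (fun q : Fin 3 → ℝ => q 0 * Real.cos (q 1)) _ q :=
    (hasFDerivAt_apply 0 q).mul (hasFDerivAt_apply (𝕜 := ℝ) 1 q).cos
  have h1 : HasFDerivAt (fun q : Fin 3 → ℝ => q 0 * Real.sin (q 1)) _ q :=
    (hasFDerivAt_apply 0 q).mul (hasFDerivAt_apply (𝕜 := ℝ) 1 q).sin
  have h2 : HasFDerivAt (fun q : Fin 3 → ℝ => q 2) _ q := hasFDerivAt_apply (𝕜 := ℝ) 2 q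
  have hd : DifferentiableAt ℝ cyl q := by
    rw [differentiableAt_pi]
    intro i
    fin_cases i
    · exact h0.differentiableAt
    · exact h1.differentiableAt
    · exact h2.differentiableAt
  have hi : ∀ i, fderiv ℝ cyl q w i = fderiv ℝ (fun q => cyl q i) q w := by
    intro i
    rw [((hasFDerivAt_pi'.1 hd.hasFDerivAt) i).fderiv]
    rfl
  funext i
  rw [hi]
  fin_cases i
  · change fderiv ℝ (fun q : Fin 3 → ℝ => q 0 * Real.cos (q 1)) q w = _
    rw [h0.fderiv]
    simp
    ring
  · change fderiv ℝ (fun q : Fin 3 → ℝ => q 0 * Real.sin (q 1)) q w = _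
    rw [h1.fderiv]
    simp
    ring
  · change fderiv ℝ (fun q : Fin 3 → ℝ => q 2) q w = _
    rw [h2.fderiv]
    simp

theorem radius_cyl {q : Fin 3 → ℝ} (hq : 0 < q 0) : radius (cyl q) = q 0 := by
  have h : (q 0 * Real.cos (q 1)) ^ 2 + (q 0 * Real.sin (q 1)) ^ 2 = q 0 ^ 2 := by
    linear_combination (q 0 ^ 2) * Real.cos_sq_add_sin_sq (q 1)
  simp only [radius, cyl, Matrix.cons_val_zero, Matrix.cons_val_one]
  rw [h, Real.sqrt_sq hq.le]

/-- The quadratic form of a squared symmetric matrix is `|B X|²`, so only `B` has to be expressed in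
cylindrical coordinates. -/
theorem hasSpiralLineElement_spiralMetric {h : ℝ → ℝ} {β : (Fin 3 → ℝ) → ℝ}
    (hβ : ContDiff ℝ ∞ β) (hh : ∀ p, β p * radius p ^ 2 = h (radius p)) :
    HasSpiralLineElement h (spiralMetric β) := by
  refine ⟨fun i j => (contDiff_spiralMetric hβ i j).contDiffOn, spiralMetric_isSymm β, ?_⟩
  intro q hq w
  have h1 := hh (cyl q)
  rw [radius_cyl hq] at h1
  have hb : β (cyl q) = h (q 0) / q 0 ^ 2 := by field_simp; linarith
  have h2 : ∀ X, ip (spiralMetric β) (cyl q) X X =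
      (spiralRoot β (cyl q) *ᵥ X) ⬝ᵥ (spiralRoot β (cyl q) *ᵥ X) := by
    intro X
    rw [ip, spiralMetric, ← Matrix.mulVec_mulVec, Matrix.dotProduct_mulVec,
      ← Matrix.mulVec_transpose, (spiralRoot_isSymm β (cyl q)).eq]
  rw [h2, fderiv_cyl]
  have hsc := Real.sin_sq_add_cos_sq (q 1)
  have hB : spiralRoot β (cyl q) = !![1 - 2 * (q 2 ^ 2 * h (q 0)) * (Real.cos (q 1) * Real.sin (q 1)),
      q 2 ^ 2 * h (q 0) * (Real.cos (q 1) ^ 2 - Real.sin (q 1) ^ 2), 0;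
      q 2 ^ 2 * h (q 0) * (Real.cos (q 1) ^ 2 - Real.sin (q 1) ^ 2),
      1 + 2 * (q 2 ^ 2 * h (q 0)) * (Real.cos (q 1) * Real.sin (q 1)), 0; 0, 0, 1] := by
    have := hq.ne'
    ext i j
    fin_cases i <;> fin_cases j <;>
      (simp only [spiralRoot, hb]; simp [angularMatrix, cyl]) <;> field_simp <;> ring
  rw [hB]
  simp [Matrix.mulVec, dotProduct, Fin.sum_univ_three]
  generalize Real.cos (q 1) = c at *
  generalize Real.sin (q 1) = s at *
  generalize h (q 0) = a at *
  have hs : s ^ 2 = 1 - c ^ 2 := by linarith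
  have hs4 : s ^ 4 = (1 - c ^ 2) ^ 2 := by rw [← hs]; ring
  have hs6 : s ^ 6 = (1 - c ^ 2) ^ 3 := by rw [← hs]; ring
  ring_nf
  simp only [hs, hs4, hs6]
  ring

/-- The line element fixes the quadratic form off the axis, polarization recovers the components,
and continuity extends the equality. The dense set `p 0 ≠ 0`, which avoids the axis, is enough. -/
theorem HasSpiralLineElement.unique {h : ℝ → ℝ} {g g' : TensorField 3}
    (hg : HasSpiralLineElement h g) (hg' : HasSpiralLineElement h g') : g = g' := by
  have hquad : ∀ p : Fin 3 → ℝ, p 0 ≠ 0 → ∀ X, ip g p X X = ip g' p X X := by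
    intro p hp X
    obtain ⟨r, φ, hr, hc, hs⟩ : ∃ r φ : ℝ, 0 < r ∧ r * Real.cos φ = p 0 ∧ r * Real.sin φ = p 1 :=
      ⟨‖(⟨p 0, p 1⟩ : ℂ)‖, Complex.arg ⟨p 0, p 1⟩,
        norm_pos_iff.2 fun h => hp (by simpa using congrArg Complex.re h),
        Complex.norm_mul_cos_arg _, Complex.norm_mul_sin_arg _⟩
    have hsc := Real.sin_sq_add_cos_sq φ
    set q : Fin 3 → ℝ := ![r, φ, p 2] with hq
    have hpq : cyl q = p := by
      funext i
      fin_cases i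
      · simpa [cyl, hq] using hc
      · simpa [cyl, hq] using hs
      · simp [cyl, hq]
    -- The preimage of `X` under the Jacobian of the cylindrical coordinates: its radial, angular
    -- and vertical components.
    set w : Fin 3 → ℝ := ![Real.cos φ * X 0 + Real.sin φ * X 1,
      (Real.cos φ * X 1 - Real.sin φ * X 0) / r, X 2] with hw
    have hX : fderiv ℝ cyl q w = X := by
      rw [fderiv_cyl]
      funext i
      fin_cases i
      · simp [hq, hw]; field_simp; linear_combination (X 0) * hsc
      · simp [hq, hw]; field_simp; linear_combination (X 1) * hsc
      · simp [hw]
    have h1 := hg.lineElement q hr w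
    have h2 := hg'.lineElement q hr w
    rw [hX, hpq] at h1 h2
    rw [h1, h2]
  have hentry : ∀ p : Fin 3 → ℝ, p 0 ≠ 0 → ∀ i j, g p i j = g' p i j := by
    intro p hp i j
    have hsum : ∀ T : TensorField 3, (T p).IsSymm →
        ip T p (Pi.single i 1 + Pi.single j 1) (Pi.single i 1 + Pi.single j 1) =
          ip T p (Pi.single i 1) (Pi.single i 1) + ip T p (Pi.single j 1) (Pi.single j 1)
            + 2 * T p i j := by
      intro T hT
      have := hT.apply i j
      simp only [ip, Matrix.mulVec_add, dotProduct_add, add_dotProduct]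
      simp [this]
      ring
    have h1 := hquad p hp (Pi.single i 1 + Pi.single j 1)
    rw [hsum g (hg.symm p), hsum g' (hg'.symm p), hquad p hp, hquad p hp] at h1
    linarith
  have hdense : Dense {p : Fin 3 → ℝ | p 0 ≠ 0} :=
    (dense_compl_singleton (0 : ℝ)).preimage (isOpenMap_eval (0 : Fin 3))
  funext p
  ext i j
  exact congrFun (Continuous.ext_on hdense (contDiffOn_univ.1 (hg.smooth i j)).continuous
    (contDiffOn_univ.1 (hg'.smooth i j)).continuous fun p hp => hentry p hp i j) p

/-! ### Profiles -/

/-- The function `h(r) / r²` on space. -/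
def spiralProfile (h : ℝ → ℝ) (p : Fin 3 → ℝ) : ℝ := h (radius p) / radius p ^ 2

theorem contDiff_radius_sq : ContDiff ℝ ∞ fun p : Fin 3 → ℝ => p 0 ^ 2 + p 1 ^ 2 := by fun_prop

theorem FlatAtZero.contDiff_comp_radius {h : ℝ → ℝ} (hh : FlatAtZero h) :
    ContDiff ℝ ∞ fun p => h (radius p) :=
  hh.comp_sqrt.1.comp contDiff_radius_sq

theorem FlatAtZero.contDiff_spiralProfile {h : ℝ → ℝ} (hh : FlatAtZero h) :
    ContDiff ℝ ∞ (spiralProfile h) := by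
  have : spiralProfile h = (fun s => h (√s) / s) ∘ fun p : Fin 3 → ℝ => p 0 ^ 2 + p 1 ^ 2 := by
    funext p
    simp only [spiralProfile, Function.comp_apply, radius_sq]
    rfl
  rw [this]
  exact hh.comp_sqrt_div.1.comp contDiff_radius_sq

theorem FlatAtZero.spiralProfile_mul {h : ℝ → ℝ} (hh : FlatAtZero h) (p : Fin 3 → ℝ) :
    spiralProfile h p * radius p ^ 2 = h (radius p) := by
  by_cases hr : radius p = 0
  · simp [hr, hh.2 0 le_rfl]
  · rw [spiralProfile]; field_simp

/-- A smooth cut-off function of `a`, equal to one for `4 a² ≤ 1`. -/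
def cutoff (a : ℝ) : ℝ := Real.smoothTransition (2 - 4 * a ^ 2)

theorem contDiff_cutoff : ContDiff ℝ ∞ cutoff :=
  Real.smoothTransition.contDiff.comp (by fun_prop)

/-- Where `2 a² ≥ 1` the cut-off is zero; elsewhere it is at most one and `a² < 1/2`. -/
theorem cutoff_mul_sq_lt (a : ℝ) : (cutoff a * a) ^ 2 < 1 := by
  rcases le_or_gt (2 - 4 * a ^ 2) 0 with h | h
  · simp [cutoff, Real.smoothTransition.zero_of_nonpos h]
  · have h0 := Real.smoothTransition.nonneg (2 - 4 * a ^ 2)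
    have h1 := Real.smoothTransition.le_one (2 - 4 * a ^ 2)
    have h2 : cutoff a ^ 2 ≤ 1 := pow_le_one₀ h0 h1
    rw [mul_pow]
    nlinarith [sq_nonneg a]

theorem cutoff_eq_one {a : ℝ} (ha : 4 * a ^ 2 ≤ 1) : cutoff a = 1 :=
  Real.smoothTransition.one_of_one_le (by linarith)

/-- The profile of a metric on the whole space. -/
def cutoffProfile (h : ℝ → ℝ) (p : Fin 3 → ℝ) : ℝ :=
  cutoff (h (radius p) * p 2 ^ 2) * spiralProfile h p

theorem FlatAtZero.contDiff_cutoffProfile {h : ℝ → ℝ} (hh : FlatAtZero h) :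
    ContDiff ℝ ∞ (cutoffProfile h) :=
  (contDiff_cutoff.comp (hh.contDiff_comp_radius.mul ((contDiff_apply ℝ ℝ 2).pow 2))).mul
    hh.contDiff_spiralProfile

/-- With `a = h(r) z²`, the determinant of the root becomes `1 - (cutoff a · a)²`, which is positive
everywhere. -/
theorem FlatAtZero.isRiemannianOn_cutoff {h : ℝ → ℝ} (hh : FlatAtZero h) :
    IsRiemannianOn univ (spiralMetric (cutoffProfile h)) := by
  refine ⟨fun i j => (contDiff_spiralMetric hh.contDiff_cutoffProfile i j).contDiffOn,
    fun p _ => ?_⟩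
  rw [spiralMetric_posDef_iff, cutoffProfile, mul_assoc, hh.spiralProfile_mul]
  refine ne_of_lt (lt_of_eq_of_lt ?_ (cutoff_mul_sq_lt (h (radius p) * p 2 ^ 2)))
  ring

theorem FlatAtZero.isOpen_regularRegion {h : ℝ → ℝ} (hh : FlatAtZero h) :
    IsOpen (regularRegion h) :=
  isOpen_lt ((hh.contDiff_comp_radius.continuous.pow 2).mul ((continuous_apply 2).pow 4))
    continuous_const

theorem planeZ_subset_regularRegion (h : ℝ → ℝ) : planeZ ⊆ regularRegion h := by
  intro p hp
  have : p 2 = 0 := hp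
  simp [regularRegion, this]

theorem FlatAtZero.isRiemannianOn_regularRegion {h : ℝ → ℝ} (hh : FlatAtZero h) :
    IsRiemannianOn (regularRegion h) (spiralMetric (spiralProfile h)) := by
  refine ⟨fun i j => (contDiff_spiralMetric hh.contDiff_spiralProfile i j).contDiffOn,
    fun p hp => ?_⟩
  rw [spiralMetric_posDef_iff, hh.spiralProfile_mul]
  exact ne_of_lt hp

theorem FlatAtZero.hasSpiralLineElement {h : ℝ → ℝ} (hh : FlatAtZero h) :
    HasSpiralLineElement h (spiralMetric (spiralProfile h)) :=
  hasSpiralLineElement_spiralMetric hh.contDiff_spiralProfile hh.spiralProfile_mul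

theorem FlatAtZero.exists_eqOn_cutoff {h : ℝ → ℝ} (hh : FlatAtZero h) :
    ∃ V : Set (Fin 3 → ℝ), IsOpen V ∧ planeZ ⊆ V ∧
      EqOn (spiralMetric (cutoffProfile h)) (spiralMetric (spiralProfile h)) V := by
  refine ⟨{p | 4 * (h (radius p) * p 2 ^ 2) ^ 2 < 1}, ?_, ?_, ?_⟩
  · exact isOpen_lt (continuous_const.mul
      ((hh.contDiff_comp_radius.continuous.mul ((continuous_apply 2).pow 2)).pow 2))
      continuous_const
  · intro p hp
    have : p 2 = 0 := hp
    simp [this]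
  · intro p hp
    have hc : cutoffProfile h p = spiralProfile h p := by
      rw [cutoffProfile, cutoff_eq_one (le_of_lt hp), one_mul]
    simp only [spiralMetric, spiralRoot, hc]

/-! ### Curves in a flat plane -/

theorem wedge_planar (e₀ e₁ : Fin n → ℝ) (a b c d : ℝ) :
    wedge (a • e₀ + b • e₁) (c • e₀ + d • e₁) = (a * d - b * c) • wedge e₀ e₁ := by
  ext i j
  simp only [wedge_apply, Matrix.smul_apply, Pi.add_apply, Pi.smul_apply, smul_eq_mul]
  ring

/-- A curve `x e₀ + y e₁` in the span of two orthonormal vectors, along which the metric is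
Euclidean and the Christoffel symbols vanish; `x₁`, `y₁`, `x₂`, `y₂` are the first and second
derivatives of `x` and `y`. -/
structure IsPlanarCurve (g : TensorField n) (I : Set ℝ) (e₀ e₁ : Fin n → ℝ)
    (x y x₁ y₁ x₂ y₂ : ℝ → ℝ) : Prop where
  uniqueDiffOn : UniqueDiffOn ℝ I
  dot₀₀ : e₀ ⬝ᵥ e₀ = 1
  dot₁₁ : e₁ ⬝ᵥ e₁ = 1
  dot₀₁ : e₀ ⬝ᵥ e₁ = 0
  metric : ∀ t ∈ I, g (x t • e₀ + y t • e₁) = 1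
  christoffel : ∀ t ∈ I, ∀ i j k, christoffel g i j k (x t • e₀ + y t • e₁) = 0
  deriv_x : ∀ t ∈ I, HasDerivWithinAt x (x₁ t) I t
  deriv_y : ∀ t ∈ I, HasDerivWithinAt y (y₁ t) I t
  deriv_x₁ : ∀ t ∈ I, HasDerivWithinAt x₁ (x₂ t) I t
  deriv_y₁ : ∀ t ∈ I, HasDerivWithinAt y₁ (y₂ t) I t

namespace IsPlanarCurve

variable {g : TensorField n} {I : Set ℝ} {e₀ e₁ : Fin n → ℝ} {x y x₁ y₁ x₂ y₂ : ℝ → ℝ}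

theorem wedge_ne_zero (h : IsPlanarCurve g I e₀ e₁ x y x₁ y₁ x₂ y₂) : wedge e₀ e₁ ≠ 0 := by
  intro h0
  have h1 : wedge e₀ e₁ *ᵥ e₁ = e₀ := by
    rw [wedge, Matrix.sub_mulVec, Matrix.vecMulVec_mulVec, Matrix.vecMulVec_mulVec, h.dot₁₁,
      h.dot₀₁]
    simp
  have h2 := h.dot₀₀
  rw [← h1, h0] at h2
  simp at h2

theorem vel_eq (h : IsPlanarCurve g I e₀ e₁ x y x₁ y₁ x₂ y₂) {t : ℝ} (ht : t ∈ I) :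
    vel (fun t => x t • e₀ + y t • e₁) I t = x₁ t • e₀ + y₁ t • e₁ :=
  (((h.deriv_x t ht).smul_const e₀).add ((h.deriv_y t ht).smul_const e₁)).derivWithin
    (h.uniqueDiffOn t ht)

theorem conn_eq_zero (h : IsPlanarCurve g I e₀ e₁ x y x₁ y₁ x₂ y₂) {t : ℝ} (ht : t ∈ I)
    (V X : Fin n → ℝ) : conn g (x t • e₀ + y t • e₁) V X = 0 := by
  funext i
  simp [conn, h.christoffel t ht]

theorem acc_eq (h : IsPlanarCurve g I e₀ e₁ x y x₁ y₁ x₂ y₂) {t : ℝ} (ht : t ∈ I) :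
    acc g (fun t => x t • e₀ + y t • e₁) I t = x₂ t • e₀ + y₂ t • e₁ := by
  have h1 : HasDerivWithinAt (vel (fun t => x t • e₀ + y t • e₁) I) (x₂ t • e₀ + y₂ t • e₁) I t :=
    (((h.deriv_x₁ t ht).smul_const e₀).add ((h.deriv_y₁ t ht).smul_const e₁)).congr_of_mem
      (fun s hs => h.vel_eq hs) ht
  rw [acc, covDeriv_eq (h.uniqueDiffOn t ht) h1, h.conn_eq_zero ht, add_zero]

theorem len_eq (h : IsPlanarCurve g I e₀ e₁ x y x₁ y₁ x₂ y₂) {t : ℝ} (ht : t ∈ I) (a b : ℝ) :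
    len g (x t • e₀ + y t • e₁) (a • e₀ + b • e₁) = √(a ^ 2 + b ^ 2) := by
  rw [len, ip, h.metric t ht, one_mulVec]
  congr 1
  simp only [add_dotProduct, dotProduct_add, smul_dotProduct, dotProduct_smul, h.dot₀₀, h.dot₁₁,
    h.dot₀₁, dotProduct_comm e₁ e₀, smul_eq_mul]
  ring

/-- Every bivector involved is a multiple of `e₀ ∧ e₁`, and covariant differentiation is ordinary
differentiation; comparing coefficients leaves an equation for the derivative `κ'` of the signed
curvature. -/
theorem wedgeEquation_iff (h : IsPlanarCurve g I e₀ e₁ x y x₁ y₁ x₂ y₂) {L : TensorField n}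
    {t κ' a b : ℝ} (ht : t ∈ I) (hκ : HasDerivWithinAt
      (fun s => (x₁ s * y₂ s - y₁ s * x₂ s) / √(x₁ s ^ 2 + y₁ s ^ 2) ^ 3) κ' I t)
    (hL : L (x t • e₀ + y t • e₁) *ᵥ (x₁ t • e₀ + y₁ t • e₁) = a • e₀ + b • e₁) :
    WedgeEquation g L (fun t => x t • e₀ + y t • e₁) I t ↔
      κ' = (x₁ t * b - y₁ t * a) / √(x₁ t ^ 2 + y₁ t ^ 2) := by
  have hhat : hat g L (x t • e₀ + y t • e₁) (x₁ t • e₀ + y₁ t • e₁) = a • e₀ + b • e₁ := by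
    rw [hat, h.metric t ht, inv_one, one_mulVec, hL]
  have hB : ∀ i j, HasDerivWithinAt (fun s =>
      ((1 / (len g (x s • e₀ + y s • e₁) (vel (fun t => x t • e₀ + y t • e₁) I s)) ^ 3) •
        wedge (vel (fun t => x t • e₀ + y t • e₁) I s)
          (acc g (fun t => x t • e₀ + y t • e₁) I s)) i j) ((κ' • wedge e₀ e₁) i j) I t := by
    intro i j
    refine (hκ.mul_const (wedge e₀ e₁ i j)).congr_of_mem (fun s hs => ?_) ht
    rw [h.vel_eq hs, h.acc_eq hs, h.len_eq hs, wedge_planar, smul_smul, Matrix.smul_apply,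
      smul_eq_mul]
    ring
  rw [WedgeEquation, covDeriv₂_eq (h.uniqueDiffOn t ht) hB, h.vel_eq ht, hhat, h.len_eq ht,
    wedge_planar, smul_smul, one_div_mul_eq_div]
  simp only [h.conn_eq_zero ht, Pi.zero_apply, add_zero]
  exact (smul_left_injective ℝ h.wedge_ne_zero).eq_iff

end IsPlanarCurve

/-! ### The spiral `r = t`, `φ = exp (1/t)` -/

/-- The first coordinate of the spiral. -/
def spiralX (t : ℝ) : ℝ := t * Real.cos (Real.exp (1 / t))

/-- The second coordinate of the spiral. -/
def spiralY (t : ℝ) : ℝ := t * Real.sin (Real.exp (1 / t))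

/-- The derivative of `spiralX`. -/
def spiralX₁ (t : ℝ) : ℝ :=
  Real.cos (Real.exp (1 / t)) + Real.exp (1 / t) / t * Real.sin (Real.exp (1 / t))

/-- The derivative of `spiralY`. -/
def spiralY₁ (t : ℝ) : ℝ :=
  Real.sin (Real.exp (1 / t)) - Real.exp (1 / t) / t * Real.cos (Real.exp (1 / t))

/-- The second derivative of `spiralX`. -/
def spiralX₂ (t : ℝ) : ℝ := -(Real.exp (1 / t) / t ^ 3) * Real.sin (Real.exp (1 / t))
  - Real.exp (1 / t) ^ 2 / t ^ 3 * Real.cos (Real.exp (1 / t))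

/-- The second derivative of `spiralY`. -/
def spiralY₂ (t : ℝ) : ℝ := Real.exp (1 / t) / t ^ 3 * Real.cos (Real.exp (1 / t))
  - Real.exp (1 / t) ^ 2 / t ^ 3 * Real.sin (Real.exp (1 / t))

theorem hasDerivAt_exp_one_div {t : ℝ} (ht : t ≠ 0) :
    HasDerivAt (fun t : ℝ => Real.exp (1 / t)) (-(Real.exp (1 / t) / t ^ 2)) t := by
  have h := (hasDerivAt_inv ht).exp
  simp only [one_div]
  exact h.congr_deriv (by ring)

theorem hasDerivAt_spiralX {t : ℝ} (ht : t ≠ 0) : HasDerivAt spiralX (spiralX₁ t) t := by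
  refine ((hasDerivAt_id t).mul (hasDerivAt_exp_one_div ht).cos).congr_deriv ?_
  simp only [spiralX₁, id]
  field_simp

theorem hasDerivAt_spiralY {t : ℝ} (ht : t ≠ 0) : HasDerivAt spiralY (spiralY₁ t) t := by
  refine ((hasDerivAt_id t).mul (hasDerivAt_exp_one_div ht).sin).congr_deriv ?_
  simp only [spiralY₁, id]
  field_simp
  ring

theorem hasDerivAt_spiralX₁ {t : ℝ} (ht : t ≠ 0) : HasDerivAt spiralX₁ (spiralX₂ t) t := by
  have h := hasDerivAt_exp_one_div ht
  refine (h.cos.add ((h.div (hasDerivAt_id t) ht).mul h.sin)).congr_deriv ?_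
  simp only [spiralX₂, id, Pi.div_apply]
  field_simp
  ring

theorem hasDerivAt_spiralY₁ {t : ℝ} (ht : t ≠ 0) : HasDerivAt spiralY₁ (spiralY₂ t) t := by
  have h := hasDerivAt_exp_one_div ht
  refine (h.sin.sub ((h.div (hasDerivAt_id t) ht).mul h.cos)).congr_deriv ?_
  simp only [spiralY₂, id, Pi.div_apply]
  field_simp
  ring

theorem spiral_speed_sq (t : ℝ) :
    spiralX₁ t ^ 2 + spiralY₁ t ^ 2 = 1 + (Real.exp (1 / t) / t) ^ 2 := by
  simp only [spiralX₁, spiralY₁]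
  linear_combination (1 + (Real.exp (1 / t) / t) ^ 2) * Real.sin_sq_add_cos_sq (Real.exp (1 / t))

theorem spiral_wedge {t : ℝ} (ht : t ≠ 0) : spiralX₁ t * spiralY₂ t - spiralY₁ t * spiralX₂ t =
    Real.exp (1 / t) / t ^ 3 - Real.exp (1 / t) ^ 3 / t ^ 4 := by
  simp only [spiralX₁, spiralY₁, spiralX₂, spiralY₂]
  have h := Real.sin_sq_add_cos_sq (Real.exp (1 / t))
  generalize Real.sin (Real.exp (1 / t)) = s at *
  generalize Real.cos (Real.exp (1 / t)) = c at *
  generalize Real.exp (1 / t) = E at *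
  field_simp
  linear_combination E * (t - E ^ 2) * h

/-- The fifth power of the speed times the derivative of the curvature of the spiral, for
`E = exp (1/t)`. -/
def spiralNumerator (t E : ℝ) : ℝ :=
  (-(E / t ^ 5) - 3 * E / t ^ 4 + 3 * E ^ 3 / t ^ 6 + 4 * E ^ 3 / t ^ 5) * (1 + (E / t) ^ 2)
    + 3 * (E / t ^ 3 - E ^ 3 / t ^ 4) * (E ^ 2 / t ^ 4 + E ^ 2 / t ^ 3)

theorem hasDerivAt_spiral_curvature {t : ℝ} (ht : 0 < t) : HasDerivAt
    (fun s => (spiralX₁ s * spiralY₂ s - spiralY₁ s * spiralX₂ s) /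
      √(spiralX₁ s ^ 2 + spiralY₁ s ^ 2) ^ 3)
    (spiralNumerator t (Real.exp (1 / t)) /
      ((1 + (Real.exp (1 / t) / t) ^ 2) ^ 2 * √(1 + (Real.exp (1 / t) / t) ^ 2))) t := by
  have hE := hasDerivAt_exp_one_div ht.ne'
  have hD : 0 < 1 + (Real.exp (1 / t) / t) ^ 2 := by positivity
  have hD' : HasDerivAt (fun s => 1 + (Real.exp (1 / s) / s) ^ 2)
      (-2 * (Real.exp (1 / t) ^ 2 / t ^ 4 + Real.exp (1 / t) ^ 2 / t ^ 3)) t := by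
    refine (((hE.div (hasDerivAt_id t) ht.ne').pow 2).const_add 1).congr_deriv ?_
    simp only [id, Pi.div_apply, Nat.reduceSub, pow_one, Nat.cast_ofNat]
    field_simp
    ring
  have hN : HasDerivAt (fun s => Real.exp (1 / s) / s ^ 3 - Real.exp (1 / s) ^ 3 / s ^ 4)
      (-(Real.exp (1 / t) / t ^ 5) - 3 * Real.exp (1 / t) / t ^ 4 +
        3 * Real.exp (1 / t) ^ 3 / t ^ 6 + 4 * Real.exp (1 / t) ^ 3 / t ^ 5) t := by
    refine ((hE.div (hasDerivAt_pow 3 t) (pow_pos ht 3).ne').sub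
      ((hE.pow 3).div (hasDerivAt_pow 4 t) (pow_pos ht 4).ne')).congr_deriv ?_
    simp only [Pi.pow_apply, Nat.cast_ofNat]
    field_simp
    ring
  have hS := hD'.sqrt hD.ne'
  have hSpos := Real.sqrt_pos.2 hD
  have hS2 := Real.sq_sqrt hD.le
  have h := hN.div (hS.pow 3) (pow_pos hSpos 3).ne'
  refine (h.congr_of_eventuallyEq ?_).congr_deriv ?_
  · filter_upwards [lt_mem_nhds ht] with s hs
    simp only [spiral_wedge hs.ne', spiral_speed_sq, Pi.div_apply, Pi.pow_apply]
  · simp only [Pi.pow_apply, spiralNumerator]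
    generalize √(1 + (Real.exp (1 / t) / t) ^ 2) = S at *
    rw [← hS2]
    generalize Real.exp (1 / t) = E at *
    generalize E / t ^ 3 - E ^ 3 / t ^ 4 = N
    generalize E ^ 2 / t ^ 4 + E ^ 2 / t ^ 3 = D'
    generalize -(E / t ^ 5) - 3 * E / t ^ 4 + 3 * E ^ 3 / t ^ 6 + 4 * E ^ 3 / t ^ 5 = N'
    simp only [Nat.cast_ofNat]
    field_simp
    ring

/-- The values of `k` on `(0, 1]`. -/
def spiralCoefficient (t : ℝ) : ℝ := spiralNumerator t (Real.exp (1 / t)) /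
  ((1 + (Real.exp (1 / t) / t) ^ 2) ^ 2 * (1 - (Real.exp (1 / t) / t) ^ 2))

theorem one_lt_exp_div {t : ℝ} (ht : t ∈ Ioc (0 : ℝ) 1) : 1 < Real.exp (1 / t) / t := by
  rw [lt_div_iff₀ ht.1, one_mul]
  have h1 := Real.add_one_le_exp (1 / t)
  have h2 : 0 < 1 / t := one_div_pos.2 ht.1
  linarith [ht.2]

/-- The wedge equation for the spiral, placed in a flat plane, with a multiple of `M`. -/
theorem IsPlanarCurve.spiral_wedgeEquation_iff {g L : TensorField n} {e₀ e₁ : Fin n → ℝ}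
    (h : IsPlanarCurve g (Ioc 0 1) e₀ e₁ spiralX spiralY spiralX₁ spiralY₁ spiralX₂ spiralY₂)
    {t k : ℝ} (ht : t ∈ Ioc (0 : ℝ) 1)
    (hL : L (spiralX t • e₀ + spiralY t • e₁) *ᵥ (spiralX₁ t • e₀ + spiralY₁ t • e₁) =
      k • ((-Real.sin (Real.exp (1 / t))
        - Real.exp (1 / t) / t * Real.cos (Real.exp (1 / t))) • e₀
      + (Real.cos (Real.exp (1 / t))
        - Real.exp (1 / t) / t * Real.sin (Real.exp (1 / t))) • e₁)) :
    WedgeEquation g L (fun t => spiralX t • e₀ + spiralY t • e₁) (Ioc 0 1) t ↔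
      k = spiralCoefficient t := by
  rw [smul_add, smul_smul, smul_smul] at hL
  rw [h.wedgeEquation_iff ht (hasDerivAt_spiral_curvature ht.1).hasDerivWithinAt hL,
    spiral_speed_sq]
  -- In the polar frame `v = e_r - (E/t) e_φ` and `M̂ v = -(E/t) e_r + e_φ`, whence the determinant
  -- `1 - (E/t)²`.
  have e : spiralX₁ t * (k * (Real.cos (Real.exp (1 / t))
        - Real.exp (1 / t) / t * Real.sin (Real.exp (1 / t)))) -
      spiralY₁ t * (k * (-Real.sin (Real.exp (1 / t))
        - Real.exp (1 / t) / t * Real.cos (Real.exp (1 / t)))) =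
      k * (1 - (Real.exp (1 / t) / t) ^ 2) := by
    simp only [spiralX₁, spiralY₁]
    linear_combination (k * (1 - (Real.exp (1 / t) / t) ^ 2)) *
      Real.sin_sq_add_cos_sq (Real.exp (1 / t))
  rw [e, spiralCoefficient]
  have h1 := one_lt_exp_div ht
  have hw : 1 - (Real.exp (1 / t) / t) ^ 2 ≠ 0 := by nlinarith
  have hD : 0 < 1 + (Real.exp (1 / t) / t) ^ 2 := by positivity
  have hS := (Real.sqrt_pos.2 hD).ne'
  generalize √(1 + (Real.exp (1 / t) / t) ^ 2) = S at *
  generalize spiralNumerator t (Real.exp (1 / t)) = N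
  generalize 1 + (Real.exp (1 / t) / t) ^ 2 = D at *
  generalize 1 - (Real.exp (1 / t) / t) ^ 2 = W at *
  have hD' := hD.ne'
  rw [eq_div_iff hS, eq_div_iff (mul_ne_zero (pow_ne_zero 2 hD') hw)]
  field_simp
  constructor <;> intro h <;> linarith

/-! ### The flat function `k` -/

/-- A smooth function equal to `exp (-1/t)` for `0 < t ≤ 1`, to zero for `t ≤ 0` and `3/2 ≤ t`. -/
def flatBump (t : ℝ) : ℝ := Real.smoothTransition (3 - 2 * t) * expNegInvGlue t

theorem flatAtZero_flatBump : FlatAtZero flatBump :=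
  FlatAtZero.mul_left ⟨expNegInvGlue.contDiff, fun _ ht => expNegInvGlue.zero_of_nonpos ht⟩
    (Real.smoothTransition.contDiff.comp (by fun_prop))

theorem flatBump_eq {t : ℝ} (ht : t ∈ Ioc (0 : ℝ) 1) : flatBump t = Real.exp (-(1 / t)) := by
  rw [flatBump, Real.smoothTransition.one_of_one_le (by linarith [ht.2]), one_mul, expNegInvGlue,
    if_neg (not_le.2 ht.1), one_div]

/-- `t exp (-1/t)` exceeds one for large `t`, which is why the bump is switched off at `3/2`. Before
that point `t - 1 < 1/t` (true below the golden ratio), so `t < 1 + 1/t ≤ exp (1/t)`. -/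
theorem sq_mul_flatBump_sq_lt (t : ℝ) : t ^ 2 * flatBump t ^ 2 < 1 := by
  rcases le_or_gt t 0 with h0 | h0
  · simp [flatAtZero_flatBump.2 t h0]
  rcases le_or_gt (3 / 2) t with h1 | h1
  · simp [flatBump, Real.smoothTransition.zero_of_nonpos (by linarith : 3 - 2 * t ≤ 0)]
  have hs0 := Real.smoothTransition.nonneg (3 - 2 * t)
  have hs1 := Real.smoothTransition.le_one (3 - 2 * t)
  have he : expNegInvGlue t = (Real.exp (t⁻¹))⁻¹ := by
    rw [expNegInvGlue, if_neg (not_le.2 h0), Real.exp_neg]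
  have hE : t⁻¹ + 1 ≤ Real.exp t⁻¹ := Real.add_one_le_exp _
  have hE0 := Real.exp_pos t⁻¹
  have h2 : t < Real.exp t⁻¹ := by
    refine lt_of_lt_of_le ?_ hE
    have h4 : t - 1 < t⁻¹ := by
      by_contra! h5
      have h6 := mul_inv_cancel₀ h0.ne'
      nlinarith
    linarith
  have h3 : t * flatBump t < 1 := by
    rw [flatBump, he]
    calc t * (Real.smoothTransition (3 - 2 * t) * (Real.exp t⁻¹)⁻¹)
        ≤ t * (1 * (Real.exp t⁻¹)⁻¹) := by gcongr
      _ = t / Real.exp t⁻¹ := by rw [one_mul, div_eq_mul_inv]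
      _ < 1 := (div_lt_one hE0).2 h2
  have h4 : 0 ≤ t * flatBump t := by
    rw [flatBump, he]
    positivity
  rw [← mul_pow]
  exact pow_lt_one₀ h4 h3 (by norm_num)

/-- The relative error `ε` of the approximation `k ≈ -exp (-1/t) / t`. -/
def spiralError (t : ℝ) : ℝ :=
  flatBump t * (2 + 3 * t + 3 * t ^ 2 + flatBump t ^ 2 * (t ^ 4 - 3 * t ^ 3 - t ^ 2)
      + t ^ 6 * flatBump t ^ 4) /
    ((1 + t ^ 2 * flatBump t ^ 2) ^ 2 * (1 - t ^ 2 * flatBump t ^ 2)) * flatBump t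

/-- One factor `flatBump` supplies the flatness; the other factor is smooth on the whole line
because its denominator never vanishes. -/
theorem flatAtZero_spiralError : FlatAtZero spiralError := by
  have h := flatAtZero_flatBump.1
  refine flatAtZero_flatBump.mul_left (ContDiff.div (by fun_prop) (by fun_prop) fun t => ?_)
  have h1 := sq_mul_flatBump_sq_lt t
  have h2 : 0 ≤ t ^ 2 * flatBump t ^ 2 := by positivity
  refine mul_ne_zero (pow_ne_zero 2 (by linarith)) (by linarith)

/-- In `spiralNumerator` the terms `E^5 / t^8` cancel and `E^5 / t^7` leads, against `-E^6 / t^6` in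
the denominator: this gives `-1 / (t E)`. Every remaining term carries a further power of `1 / E`.
-/
theorem spiralCoefficient_eq {t : ℝ} (ht : t ∈ Ioc (0 : ℝ) 1) :
    spiralCoefficient t = -(Real.exp (-(1 / t)) / t) * (1 + spiralError t) := by
  have h1 := one_lt_exp_div ht
  have hE := Real.exp_pos (1 / t)
  have ht0 := ht.1
  rw [spiralCoefficient, spiralError, flatBump_eq ht, Real.exp_neg, spiralNumerator]
  generalize Real.exp (1 / t) = E at *
  have hEt : t < E := by rwa [lt_div_iff₀ ht0, one_mul] at h1
  have hw : t ^ 2 - E ^ 2 ≠ 0 := by nlinarith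
  have hw' : E ^ 2 - t ^ 2 ≠ 0 := by nlinarith
  have hD : t ^ 2 + E ^ 2 ≠ 0 := by positivity
  have hD' : E ^ 2 + t ^ 2 ≠ 0 := by positivity
  have e1 : 1 + (E / t) ^ 2 = (t ^ 2 + E ^ 2) / t ^ 2 := by field_simp
  have e2 : 1 - (E / t) ^ 2 = (t ^ 2 - E ^ 2) / t ^ 2 := by field_simp
  have e3 : 1 + t ^ 2 * E⁻¹ ^ 2 = (t ^ 2 + E ^ 2) / E ^ 2 := by field_simp; ring
  have e4 : 1 - t ^ 2 * E⁻¹ ^ 2 = -((t ^ 2 - E ^ 2) / E ^ 2) := by field_simp; ring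
  rw [e1, e2, e3, e4]
  field_simp
  ring

theorem flatAtZero_spiralCoefficient :
    FlatAtZero fun t => -(1 + spiralError t) * (flatBump t / t ^ 1) :=
  (flatAtZero_flatBump.div_pow 1).mul_left (contDiff_const.add flatAtZero_spiralError.1).neg

/-! ### The spiral in the Euclidean plane -/

theorem spiralCurve₂_eq : spiralCurve₂ =
    fun t => spiralX t • (![1, 0] : Fin 2 → ℝ) + spiralY t • ![0, 1] := by
  funext t i
  fin_cases i <;> simp [spiralCurve₂, spiralX, spiralY]

theorem isPlanarCurve_spiral {g : TensorField n} {e₀ e₁ : Fin n → ℝ} (h₀₀ : e₀ ⬝ᵥ e₀ = 1)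
    (h₁₁ : e₁ ⬝ᵥ e₁ = 1) (h₀₁ : e₀ ⬝ᵥ e₁ = 0)
    (hg : ∀ t ∈ Ioc (0 : ℝ) 1, g (spiralX t • e₀ + spiralY t • e₁) = 1)
    (hΓ : ∀ t ∈ Ioc (0 : ℝ) 1, ∀ i j k,
      christoffel g i j k (spiralX t • e₀ + spiralY t • e₁) = 0) :
    IsPlanarCurve g (Ioc 0 1) e₀ e₁ spiralX spiralY spiralX₁ spiralY₁ spiralX₂ spiralY₂ where
  uniqueDiffOn := uniqueDiffOn_Ioc 0 1
  dot₀₀ := h₀₀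
  dot₁₁ := h₁₁
  dot₀₁ := h₀₁
  metric := hg
  christoffel := hΓ
  deriv_x _ ht := (hasDerivAt_spiralX ht.1.ne').hasDerivWithinAt
  deriv_y _ ht := (hasDerivAt_spiralY ht.1.ne').hasDerivWithinAt
  deriv_x₁ _ ht := (hasDerivAt_spiralX₁ ht.1.ne').hasDerivWithinAt
  deriv_y₁ _ ht := (hasDerivAt_spiralY₁ ht.1.ne').hasDerivWithinAt

theorem isPlanarCurve_spiralCurve₂ : IsPlanarCurve euclideanPlane (Ioc 0 1) ![1, 0] ![0, 1]
    spiralX spiralY spiralX₁ spiralY₁ spiralX₂ spiralY₂ := by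
  refine isPlanarCurve_spiral (by simp) (by simp) (by simp) (fun _ _ => rfl) fun t _ i j k => ?_
  simp [christoffel, pd, euclideanPlane]

theorem sqrt_spiral_sq {t : ℝ} (ht : 0 < t) :
    √((t * Real.cos (Real.exp (1 / t))) ^ 2 + (t * Real.sin (Real.exp (1 / t))) ^ 2) = t := by
  have h : (t * Real.cos (Real.exp (1 / t))) ^ 2 + (t * Real.sin (Real.exp (1 / t))) ^ 2 =
      t ^ 2 := by
    linear_combination t ^ 2 * Real.cos_sq_add_sin_sq (Real.exp (1 / t))
  rw [h, Real.sqrt_sq ht.le]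

/-- The equation is linear in `k t` with nonzero coefficient, so it prescribes `k` on `(0, 1]`;
outside, only smoothness and vanishing for `t ≤ 0` constrain it. -/
theorem isSpiralFunction_iff {k : ℝ → ℝ} : IsSpiralFunction k ↔
    FlatAtZero k ∧ ∀ t ∈ Ioc (0 : ℝ) 1, k t = spiralCoefficient t := by
  refine and_congr_right fun _ => forall₂_congr fun t ht => ?_
  have hr : radius₂ (spiralX t • (![1, 0] : Fin 2 → ℝ) + spiralY t • ![0, 1]) = t := by
    simpa [radius₂, spiralX, spiralY] using sqrt_spiral_sq ht.1
  rw [spiralCurve₂_eq]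
  refine isPlanarCurve_spiralCurve₂.spiral_wedgeEquation_iff ht ?_
  rw [Matrix.smul_mulVec]
  congr 1
  have ht0 := ht.1.ne'
  have hsc := Real.sin_sq_add_cos_sq (Real.exp (1 / t))
  funext i
  simp only [tensorM₂, hr]
  fin_cases i
  · simp [Matrix.mulVec, dotProduct, Fin.sum_univ_two, spiralX, spiralY, spiralX₁,
      spiralY₁]
    field_simp
    simp only [one_div] at *
    generalize Real.sin (Real.exp t⁻¹) = s at *
    generalize Real.cos (Real.exp t⁻¹) = c at *
    generalize Real.exp t⁻¹ = E at *
    linear_combination (-(t * s) - c * E) * hsc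
  · simp [Matrix.mulVec, dotProduct, Fin.sum_univ_two, spiralX, spiralY, spiralX₁,
      spiralY₁]
    field_simp
    simp only [one_div] at *
    generalize Real.sin (Real.exp t⁻¹) = s at *
    generalize Real.cos (Real.exp t⁻¹) = c at *
    generalize Real.exp t⁻¹ = E at *
    linear_combination (t * c - s * E) * hsc

/-! ### The length of the spiral -/

theorem lintegral_inv_Ioc_zero_one : ∫⁻ t in Ioc (0 : ℝ) 1, ENNReal.ofReal t⁻¹ = ⊤ := by
  by_contra h
  have h1 : IntegrableOn (fun t : ℝ => t⁻¹) (Ioc 0 1) := by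
    refine ⟨measurable_inv.aestronglyMeasurable, ?_⟩
    rw [hasFiniteIntegral_iff_ofReal]
    · exact lt_top_iff_ne_top.2 h
    · filter_upwards [ae_restrict_mem measurableSet_Ioc] with t ht using inv_nonneg.2 ht.1.le
  have h2 := intervalIntegrable_inv_iff.1 ((intervalIntegrable_iff_integrableOn_Ioc_of_le
    zero_le_one).2 h1)
  simp at h2

/-- The angular part of the speed is already `exp (1/t) / t ≥ 1/t`. The divergence of `∫ dt/t` at
`0` then yields both the infinite length and the unbounded range of proper time. -/
theorem inv_le_spiral_speed {t : ℝ} (ht : t ∈ Ioc (0 : ℝ) 1) :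
    t⁻¹ ≤ √(spiralX₁ t ^ 2 + spiralY₁ t ^ 2) := by
  rw [spiral_speed_sq]
  refine Real.le_sqrt_of_sq_le ?_
  have h0 : 0 < t⁻¹ := inv_pos.2 ht.1
  have h1 : 1 ≤ Real.exp (1 / t) := Real.one_le_exp (one_div_nonneg.2 ht.1.le)
  have h2 : t⁻¹ ≤ Real.exp (1 / t) / t := by
    rw [div_eq_mul_inv]
    nlinarith
  nlinarith

theorem IsPlanarCurve.len_vel {g : TensorField n} {I : Set ℝ} {e₀ e₁ : Fin n → ℝ}
    {x y x₁ y₁ x₂ y₂ : ℝ → ℝ} (h : IsPlanarCurve g I e₀ e₁ x y x₁ y₁ x₂ y₂) {t : ℝ} (ht : t ∈ I) :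
    len g (x t • e₀ + y t • e₁) (vel (fun t => x t • e₀ + y t • e₁) I t) =
      √(x₁ t ^ 2 + y₁ t ^ 2) := by
  rw [h.vel_eq ht, h.len_eq ht]

theorem IsPlanarCurve.spiral_curveLength {g : TensorField n} {e₀ e₁ : Fin n → ℝ}
    (h : IsPlanarCurve g (Ioc 0 1) e₀ e₁ spiralX spiralY spiralX₁ spiralY₁ spiralX₂ spiralY₂) :
    curveLength g (fun t => spiralX t • e₀ + spiralY t • e₁) (Ioc 0 1) = ⊤ := by
  rw [eq_top_iff, ← lintegral_inv_Ioc_zero_one, curveLength]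
  refine setLIntegral_mono' measurableSet_Ioc fun t ht => ?_
  rw [h.len_vel ht]
  exact ENNReal.ofReal_le_ofReal (inv_le_spiral_speed ht)

/-! ### The spiral in space -/

theorem spiralCurve_eq : spiralCurve =
    fun t => spiralX t • (![1, 0, 0] : Fin 3 → ℝ) + spiralY t • ![0, 1, 0] := by
  funext t i
  fin_cases i <;> simp [spiralCurve, spiralX, spiralY]

theorem spiralCurve_mem_planeZ (t : ℝ) : spiralCurve t ∈ planeZ := by
  simp [planeZ, spiralCurve]

theorem radius_spiralCurve {t : ℝ} (ht : 0 < t) : radius (spiralCurve t) = t := by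
  simpa [radius, spiralCurve] using sqrt_spiral_sq ht

theorem contDiffOn_spiralCurve : ContDiffOn ℝ ∞ spiralCurve (Ioc 0 1) := by
  have hE : ContDiffOn ℝ ∞ (fun t : ℝ => Real.exp (1 / t)) (Ioc 0 1) :=
    (contDiffOn_const.div contDiffOn_id fun t ht => ht.1.ne').exp
  refine contDiffOn_pi.2 fun i => ?_
  fin_cases i
  · exact contDiffOn_id.mul hE.cos
  · exact contDiffOn_id.mul hE.sin
  · exact contDiffOn_const

theorem isPlanarCurve_spiralCurve {β : (Fin 3 → ℝ) → ℝ} (hβ : ContDiff ℝ ∞ β) :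
    IsPlanarCurve (spiralMetric β) (Ioc 0 1) ![1, 0, 0] ![0, 1, 0]
      spiralX spiralY spiralX₁ spiralY₁ spiralX₂ spiralY₂ := by
  have hmem : ∀ t, spiralX t • (![1, 0, 0] : Fin 3 → ℝ) + spiralY t • ![0, 1, 0] ∈ planeZ :=
    fun t => by simp [planeZ]
  exact isPlanarCurve_spiral (by simp) (by simp) (by simp)
    (fun t _ => eq_one_on_planeZ (spiralMetric_eq β) (hmem t))
    fun t _ => christoffel_spiralMetric hβ (hmem t)

theorem len_vel_spiralCurve {β : (Fin 3 → ℝ) → ℝ} (hβ : ContDiff ℝ ∞ β) {t : ℝ}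
    (ht : t ∈ Ioc (0 : ℝ) 1) : len (spiralMetric β) (spiralCurve t)
      (vel spiralCurve (Ioc 0 1) t) = √(spiralX₁ t ^ 2 + spiralY₁ t ^ 2) := by
  rw [spiralCurve_eq]
  exact (isPlanarCurve_spiralCurve hβ).len_vel ht

theorem spiral_speed_pos (t : ℝ) : 0 < √(spiralX₁ t ^ 2 + spiralY₁ t ^ 2) := by
  rw [spiral_speed_sq]
  positivity

theorem vel_spiralCurve_ne_zero {t : ℝ} (ht : t ∈ Ioc (0 : ℝ) 1) :
    vel spiralCurve (Ioc 0 1) t ≠ 0 := by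
  intro h
  -- The coordinate velocity does not depend on the metric, so the Euclidean case `β = 0` decides.
  have h1 := len_vel_spiralCurve (β := fun _ => 0) contDiff_const ht
  rw [h] at h1
  have h2 := spiral_speed_pos t
  rw [← h1] at h2
  simp [len, ip] at h2

/-- The hypothesis on `β` makes the Schouten tensor `k M` along the curve, so the scalar equation is
the one that `k` satisfies in the Euclidean plane. -/
theorem wedgeEquation_spiralCurve {β : (Fin 3 → ℝ) → ℝ} (hβ : ContDiff ℝ ∞ β) {k : ℝ → ℝ}
    (hk : IsSpiralFunction k)
    (hβk : ∀ p ∈ planeZ, -2 * (β p * radius p ^ 2) = k (radius p)) {t : ℝ}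
    (ht : t ∈ Ioc (0 : ℝ) 1) :
    WedgeEquation (spiralMetric β) (schouten (spiralMetric β)) spiralCurve (Ioc 0 1) t := by
  have hr := radius_spiralCurve ht.1
  have hmem := spiralCurve_mem_planeZ t
  have hL := schouten_spiralMetric hβ hmem
  rw [hβk _ hmem, hr] at hL
  rw [spiralCurve_eq] at hL hr ⊢
  refine ((isPlanarCurve_spiralCurve hβ).spiral_wedgeEquation_iff ht ?_).2
    ((isSpiralFunction_iff.1 hk).2 t ht)
  rw [hL, Matrix.smul_mulVec]
  congr 1
  have ht0 := ht.1.ne'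
  have hsc := Real.sin_sq_add_cos_sq (Real.exp (1 / t))
  funext i
  simp only [tensorM, hr]
  fin_cases i
  · simp [Matrix.mulVec, dotProduct, Fin.sum_univ_three, spiralX, spiralY, spiralX₁, spiralY₁]
    field_simp
    simp only [one_div] at *
    generalize Real.sin (Real.exp t⁻¹) = s at *
    generalize Real.cos (Real.exp t⁻¹) = c at *
    generalize Real.exp t⁻¹ = E at *
    linear_combination (-(t * s) - c * E) * hsc
  · simp [Matrix.mulVec, dotProduct, Fin.sum_univ_three, spiralX, spiralY, spiralX₁, spiralY₁]
    field_simp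
    simp only [one_div] at *
    generalize Real.sin (Real.exp t⁻¹) = s at *
    generalize Real.cos (Real.exp t⁻¹) = c at *
    generalize Real.exp t⁻¹ = E at *
    linear_combination (t * c - s * E) * hsc
  · simp [Matrix.mulVec, dotProduct, Fin.sum_univ_three]

theorem curveLength_spiralCurve {β : (Fin 3 → ℝ) → ℝ} (hβ : ContDiff ℝ ∞ β) :
    curveLength (spiralMetric β) spiralCurve (Ioc 0 1) = ⊤ := by
  rw [spiralCurve_eq]
  exact (isPlanarCurve_spiralCurve hβ).spiral_curveLength

/-! ### Reparametrization by proper time -/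

/-- Arc length measured from `t = 1` is nonpositive on `(0, 1]`; reversing its sign gives a proper
time on `[0, ∞)` that runs towards the origin. -/
theorem IsReparametrization.comp_neg {τ : ℝ → ℝ} {I : Set ℝ}
    (h : IsReparametrization τ (Iic 0) I) :
    IsReparametrization (fun s => τ (-s)) (Ici 0) I ∧
      ∀ s ∈ Ici (0 : ℝ), derivWithin (fun s => τ (-s)) (Ici 0) s =
        -derivWithin τ (Iic 0) (-s) := by
  have hmaps : MapsTo (fun s : ℝ => -s) (Ici 0) (Iic 0) := fun s hs => by simpa using hs
  have hder : ∀ s ∈ Ici (0 : ℝ), derivWithin (fun s => τ (-s)) (Ici 0) s =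
      -derivWithin τ (Iic 0) (-s) := by
    intro s hs
    have h1 := (h.hasDerivWithinAt (hmaps hs)).scomp s ((hasDerivAt_neg s).hasDerivWithinAt) hmaps
    simpa [Function.comp_def] using h1.derivWithin (uniqueDiffOn_Ici 0 s hs)
  refine ⟨⟨ordConnected_Ici, ⟨0, by simp, 1, by simp, by norm_num⟩,
    h.smooth.comp contDiff_neg.contDiffOn hmaps, ?_, fun s hs => ?_⟩, hder⟩
  · refine h.bijOn.comp ⟨hmaps, neg_injective.injOn, fun s hs => ⟨-s, ?_, neg_neg s⟩⟩
    simpa using hs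
  · rw [hder s hs]
    exact neg_ne_zero.2 (h.deriv_ne _ (hmaps hs))

/-- The arc length of the spiral, measured from its end point. -/
def spiralArcLength (t : ℝ) : ℝ := ∫ x in (1 : ℝ)..t, √(spiralX₁ x ^ 2 + spiralY₁ x ^ 2)

theorem contDiffOn_spiral_speed :
    ContDiffOn ℝ ∞ (fun t => √(spiralX₁ t ^ 2 + spiralY₁ t ^ 2)) (Ioc 0 1) := by
  simp only [spiral_speed_sq]
  have hE : ContDiffOn ℝ ∞ (fun t : ℝ => Real.exp (1 / t)) (Ioc 0 1) :=
    (contDiffOn_const.div contDiffOn_id fun t ht => ht.1.ne').exp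
  refine (contDiffOn_const.add ((hE.div contDiffOn_id fun t ht => ht.1.ne').pow 2)).sqrt
    fun t _ => ?_
  positivity

theorem hasDerivWithinAt_spiralArcLength {t : ℝ} (ht : t ∈ Ioc (0 : ℝ) 1) :
    HasDerivWithinAt spiralArcLength √(spiralX₁ t ^ 2 + spiralY₁ t ^ 2) (Ioc 0 1) t :=
  hasDerivWithinAt_integral_of_ordConnected ordConnected_Ioc contDiffOn_spiral_speed.continuousOn
    (right_mem_Ioc.2 zero_lt_one) ht

theorem strictMonoOn_spiralArcLength : StrictMonoOn spiralArcLength (Ioc 0 1) :=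
  strictMonoOn_of_hasDerivWithinAt_pos ordConnected_Ioc
    (fun _ ht => hasDerivWithinAt_spiralArcLength ht) fun t _ => spiral_speed_pos t

theorem spiralArcLength_one : spiralArcLength 1 = 0 := by simp [spiralArcLength]

theorem spiralArcLength_le_log {t : ℝ} (ht : t ∈ Ioc (0 : ℝ) 1) :
    spiralArcLength t ≤ Real.log t := by
  have hsub : Icc t 1 ⊆ Ioc 0 1 := fun x hx => ⟨ht.1.trans_le hx.1, hx.2⟩
  have h1 : ∫ x in t..1, x⁻¹ ≤ ∫ x in t..1, √(spiralX₁ x ^ 2 + spiralY₁ x ^ 2) := by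
    refine intervalIntegral.integral_mono_on ht.2 ?_ ?_ fun x hx => inv_le_spiral_speed (hsub hx)
    · refine intervalIntegral.intervalIntegrable_inv (fun x hx => ?_) continuousOn_id
      rw [uIcc_of_le ht.2] at hx
      exact (hsub hx).1.ne'
    · refine ContinuousOn.intervalIntegrable (contDiffOn_spiral_speed.continuousOn.mono ?_)
      rwa [uIcc_of_le ht.2]
  rw [integral_inv_of_pos ht.1 one_pos, one_div, Real.log_inv] at h1
  rw [spiralArcLength, intervalIntegral.integral_symm]
  linarith

theorem image_spiralArcLength : spiralArcLength '' Ioc 0 1 = Iic 0 := by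
  have h1 : (1 : ℝ) ∈ Ioc (0 : ℝ) 1 := right_mem_Ioc.2 zero_lt_one
  apply Subset.antisymm
  · rintro _ ⟨t, ht, rfl⟩
    exact (spiralArcLength_le_log ht).trans (Real.log_nonpos ht.1.le ht.2)
  · intro s hs
    have hc : (spiralArcLength '' Ioc 0 1).OrdConnected :=
      (isPreconnected_Ioc.image _
        fun t ht => (hasDerivWithinAt_spiralArcLength ht).continuousWithinAt).ordConnected
    -- By the logarithmic bound the arc length at `exp s` is at most `s`, while at `1` it is `0 ≥
    -- s`; the intermediate value `s` is attained.
    have h2 : Real.exp s ∈ Ioc (0 : ℝ) 1 := ⟨Real.exp_pos s, Real.exp_le_one_iff.2 hs⟩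
    refine hc.out (mem_image_of_mem _ h2) (mem_image_of_mem _ h1) ⟨?_, ?_⟩
    · simpa using spiralArcLength_le_log h2
    · rwa [spiralArcLength_one]

/-- The inverse of the arc length, on `[0, ∞)`. -/
def spiralParameter (s : ℝ) : ℝ := Function.invFunOn spiralArcLength (Ioc 0 1) (-s)

theorem isReparametrization_spiralParameter :
    IsReparametrization spiralParameter (Ici 0) (Ioc 0 1) ∧ ∀ s ∈ Ici (0 : ℝ),
      |derivWithin spiralParameter (Ici 0) s| * √(spiralX₁ (spiralParameter s) ^ 2
        + spiralY₁ (spiralParameter s) ^ 2) = 1 := by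
  obtain ⟨h1, h2⟩ := isReparametrization_invFunOn ordConnected_Ioc
    ⟨1, by simp, 1 / 2, by norm_num, by norm_num⟩
    (fun _ ht => hasDerivWithinAt_spiralArcLength ht) contDiffOn_spiral_speed
    fun t _ => spiral_speed_pos t
  rw [image_spiralArcLength] at h1 h2
  obtain ⟨h3, h4⟩ := h1.comp_neg
  refine ⟨h3, fun s hs => ?_⟩
  have h5 := h4 s hs
  have hpos := spiral_speed_pos (spiralParameter s)
  change derivWithin spiralParameter (Ici 0) s = _ at h5
  rw [h5, h2 (-s) (by simpa using hs), abs_neg]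
  unfold spiralParameter at hpos ⊢
  rw [abs_of_pos (inv_pos.2 hpos)]
  exact inv_mul_cancel₀ hpos.ne'

theorem tendsto_spiralParameter : Tendsto spiralParameter atTop (𝓝 0) := by
  have hmem : ∀ s ∈ Ici (0 : ℝ), spiralParameter s ∈ Ioc (0 : ℝ) 1 :=
    isReparametrization_spiralParameter.1.bijOn.mapsTo
  rw [Metric.tendsto_atTop]
  intro δ hδ
  -- The truncation keeps the threshold in the domain, where strict monotonicity turns a large arc
  -- length into a small parameter.
  have he : min δ 1 ∈ Ioc (0 : ℝ) 1 := ⟨lt_min hδ one_pos, min_le_right _ _⟩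
  refine ⟨max 0 (1 - spiralArcLength (min δ 1)), fun s hs => ?_⟩
  have hs0 : s ∈ Ici (0 : ℝ) := (le_max_left _ _).trans hs
  have hs1 : 1 - spiralArcLength (min δ 1) ≤ s := (le_max_right _ _).trans hs
  have hm := hmem s hs0
  have hσ : spiralArcLength (spiralParameter s) = -s :=
    Function.invFunOn_eq (by rw [← mem_image, image_spiralArcLength]; simpa using hs0)
  rw [Real.dist_eq, sub_zero, abs_of_pos hm.1]
  refine lt_of_lt_of_le ?_ (min_le_left δ 1)
  rw [← strictMonoOn_spiralArcLength.lt_iff_lt hm he, hσ]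
  linarith

theorem tendsto_spiralCurve_comp : Tendsto (spiralCurve ∘ spiralParameter) atTop (𝓝 0) := by
  rw [tendsto_pi_nhds]
  have h := tendsto_spiralParameter
  intro i
  fin_cases i
  · exact squeeze_zero_norm (fun s => by
      simpa [spiralCurve, abs_mul] using mul_le_of_le_one_right (abs_nonneg _)
        (Real.abs_cos_le_one _)) (by simpa using h.abs)
  · exact squeeze_zero_norm (fun s => by
      simpa [spiralCurve, abs_mul] using mul_le_of_le_one_right (abs_nonneg _)
        (Real.abs_sin_le_one _)) (by simpa using h.abs)
  · exact tendsto_const_nhds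

/-- Only the values of `β r²` on the plane enter, so the argument serves both `g_h` on its regular
region and the damped metric on all of space. -/
theorem isSpiralingConformalGeodesic_spiralCurve {β : (Fin 3 → ℝ) → ℝ} (hβ : ContDiff ℝ ∞ β)
    {U : Set (Fin 3 → ℝ)} (hU : IsOpen U) (hpl : planeZ ⊆ U)
    (hg : IsRiemannianOn U (spiralMetric β)) {k : ℝ → ℝ} (hk : IsSpiralFunction k)
    (hβk : ∀ p ∈ planeZ, -2 * (β p * radius p ^ 2) = k (radius p)) :
    IsSpiralingConformalGeodesic (spiralMetric β) spiralCurve (Ioc 0 1) 0 := by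
  obtain ⟨h1, h2⟩ := isReparametrization_spiralParameter
  have hgeo := isConformalGeodesic_comp hU hg (uniqueDiffOn_Ioc 0 1) contDiffOn_spiralCurve
    (fun t _ => hpl (spiralCurve_mem_planeZ t)) (fun t ht => vel_spiralCurve_ne_zero ht) h1
    (fun s hs => by rw [len_vel_spiralCurve hβ (h1.bijOn.mapsTo hs)]; exact h2 s hs)
    fun t ht => wedgeEquation_spiralCurve hβ hk hβk ht
  exact ⟨spiralParameter, h1, hgeo, hgeo.toIsProperTimeCurve, tendsto_spiralCurve_comp⟩

theorem IsSpiralingConformalGeodesic.isUnparametrizedConformalGeodesic {g : TensorField n}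
    {γ : ℝ → Fin n → ℝ} {I : Set ℝ} {p : Fin n → ℝ} (h : IsSpiralingConformalGeodesic g γ I p) :
    IsUnparametrizedConformalGeodesic g γ I := by
  obtain ⟨τ, h1, h2, -⟩ := h
  exact ⟨Ici 0, τ, h1, h2⟩

end ConfGeo

end

open ConfGeo
theorem mainTheorem1 :
    -- the wedge-product forms of the conformal geodesic equation
    (∀ (n : ℕ), 3 ≤ n → ∀ (U : Set (Fin n → ℝ)) (g : TensorField n), IsOpen U →
      IsRiemannianOn U g → ∀ (I : Set ℝ) (γ : ℝ → Fin n → ℝ), I.OrdConnected → I.Nontrivial →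
      ContDiffOn ℝ ∞ γ I → MapsTo γ I U →
        (IsConformalGeodesic g γ I ↔
          ∀ s ∈ I, len g (γ s) (vel γ I s) = 1 ∧
            covDeriv₂ g γ I (fun s' => wedge (vel γ I s') (acc g γ I s')) s =
              wedge (vel γ I s) (hat g (schouten g) (γ s) (vel γ I s))) ∧
        ((∀ t ∈ I, vel γ I t ≠ 0) →
          (IsUnparametrizedConformalGeodesic g γ I ↔
            ∀ t ∈ I, WedgeEquation g (schouten g) γ I t))) ∧
    -- the metric of a flat function `h`
    (∀ h : ℝ → ℝ, FlatAtZero h →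
      (∃! g : TensorField 3, HasSpiralLineElement h g) ∧
      ∀ g : TensorField 3, HasSpiralLineElement h g →
        (∀ p, (g p).PosDef ↔ h (radius p) ^ 2 * p 2 ^ 4 ≠ 1) ∧
        IsOpen (regularRegion h) ∧ planeZ ⊆ regularRegion h ∧
        IsRiemannianOn (regularRegion h) g ∧
        -- the plane `z = 0` is flat, it is totally geodesic, and `Ric = -2 h M` on it
        (∀ p ∈ planeZ, ∀ X Y : Fin 3 → ℝ, X 2 = 0 → Y 2 = 0 →
          ip g p X Y = X 0 * Y 0 + X 1 * Y 1 ∧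
          ∑ i, ∑ j, christoffel g 2 i j p * X i * Y j = 0) ∧
        (∀ p ∈ planeZ, ricci g p = (-2 * h (radius p)) • tensorM p)) ∧
    -- the function `k`
    (∃ k : ℝ → ℝ, IsSpiralFunction k) ∧
    curveLength euclideanPlane spiralCurve₂ (Ioc 0 1) = ⊤ ∧
    ∀ k : ℝ → ℝ, IsSpiralFunction k →
      (∃ ε : ℝ → ℝ, FlatAtZero ε ∧
        ∀ t ∈ Ioc (0 : ℝ) 1, k t = -(Real.exp (-(1 / t)) / t) * (1 + ε t)) ∧
      -- the spiraling conformal geodesic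
      ∀ g : TensorField 3, HasSpiralLineElement (fun r => -(1 / 2) * k r) g →
        MapsTo spiralCurve (Ioc 0 1) planeZ ∧
        IsUnparametrizedConformalGeodesic g spiralCurve (Ioc 0 1) ∧
        curveLength g spiralCurve (Ioc 0 1) = ⊤ ∧
        IsSpiralingConformalGeodesic g spiralCurve (Ioc 0 1) 0 ∧
        -- the same for a metric that is positive definite on the whole of `ℝ³`
        ∃ G : TensorField 3, IsRiemannianOn univ G ∧
          (∃ V : Set (Fin 3 → ℝ), IsOpen V ∧ planeZ ⊆ V ∧ EqOn G g V) ∧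
          IsUnparametrizedConformalGeodesic G spiralCurve (Ioc 0 1) ∧
          IsSpiralingConformalGeodesic G spiralCurve (Ioc 0 1) 0 := by
  refine ⟨?_, ?_, ?_, ?_, ?_⟩
  · intro n _ U g hU hg I γ hI hn hγ hm
    exact ⟨isConformalGeodesic_iff_wedge hU hg (uniqueDiffOn_of_ordConnected hI hn) hγ hm,
      isUnparametrizedConformalGeodesic_iff hU hg hI hn hγ hm⟩
  · intro h hh
    refine ⟨⟨_, hh.hasSpiralLineElement, fun g hg => hg.unique hh.hasSpiralLineElement⟩, ?_⟩
    intro g hg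
    obtain rfl := hg.unique hh.hasSpiralLineElement
    refine ⟨fun p => ?_, hh.isOpen_regularRegion, planeZ_subset_regularRegion h,
      hh.isRiemannianOn_regularRegion, fun p hp X Y hX hY => ⟨?_, ?_⟩, fun p hp => ?_⟩
    · rw [spiralMetric_posDef_iff, hh.spiralProfile_mul]
    · rw [ip, eq_one_on_planeZ (spiralMetric_eq _) hp, Matrix.one_mulVec]
      simp [dotProduct, Fin.sum_univ_three, hX]
    · simp [christoffel_spiralMetric hh.contDiff_spiralProfile hp]
    · rw [ricci_spiralMetric hh.contDiff_spiralProfile hp, hh.spiralProfile_mul]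
  · refine ⟨_, isSpiralFunction_iff.2 ⟨flatAtZero_spiralCoefficient, fun t ht => ?_⟩⟩
    rw [spiralCoefficient_eq ht, flatBump_eq ht]
    ring
  · rw [spiralCurve₂_eq]
    exact isPlanarCurve_spiralCurve₂.spiral_curveLength
  · intro k hk
    have hk' := isSpiralFunction_iff.1 hk
    refine ⟨⟨spiralError, flatAtZero_spiralError, fun t ht => ?_⟩, fun g hg => ?_⟩
    · rw [hk'.2 t ht, spiralCoefficient_eq ht]
    have hh : FlatAtZero fun r => -(1 / 2) * k r := hk'.1.mul_left contDiff_const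
    obtain rfl := hg.unique hh.hasSpiralLineElement
    have h1 := isSpiralingConformalGeodesic_spiralCurve hh.contDiff_spiralProfile
      hh.isOpen_regularRegion (planeZ_subset_regularRegion _) hh.isRiemannianOn_regularRegion hk
      fun p _ => by rw [hh.spiralProfile_mul]; ring
    -- On the plane the argument of the cut-off is zero, so the damped profile agrees there with the
    -- original one.
    have h2 := isSpiralingConformalGeodesic_spiralCurve hh.contDiff_cutoffProfile isOpen_univ
      (subset_univ _) hh.isRiemannianOn_cutoff hk fun p hp => by
        have hp2 : p 2 = 0 := hp
        rw [cutoffProfile, hp2, cutoff_eq_one (by norm_num), one_mul, hh.spiralProfile_mul]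
        ring
    exact ⟨fun t _ => spiralCurve_mem_planeZ t, h1.isUnparametrizedConformalGeodesic,
      curveLength_spiralCurve hh.contDiff_spiralProfile, h1, _, hh.isRiemannianOn_cutoff,
      hh.exists_eqOn_cutoff, h2.isUnparametrizedConformalGeodesic, h2⟩
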